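/- Consider the uplink of a cell-free network with $M$ access points (APs), each with $N\ge 1$ antennas, and $K$ single-antenna users. One coherence interval contains $\tau_p$ training samples and $\tau_u\ge 1$ uplink data samples. Write $\mathcal{CN}(0,v)$ for the circularly symmetric complex Gaussian law of variance $v$. **Channels.** $\mathbf g_{mk}=\sqrt{\beta_{mk}}\,\mathbf h_{mk}\in\mathbb C^N$, with $\beta_{mk}>0$ deterministic and the entries of $\mathbf h_{mk}$ distributed as $\mathcal{CN}(0,1)$; the channels are constant over the coherence interval. **Training.** Let $\psi_1,\dots,\psi_{\tau_p}\in\mathbb C^{\tau_p}$ be orthonormal, let $K\le\tau_p$, and let different users $k$ use different pilots $\psi_{i_k}$. Put $\varphi_k=\sqrt{\tau_p\rho_p}\,\psi_{i_k}$ with $\rho_p>0$. AP $m$ receives $\mathbf Y_{p,m}=\sum_{k}\mathbf g_{mk}\varphi_k^T+\mathbf W_{p,m}$, where the entries of $\mathbf W_{p,m}\in\mathbb C^{N\times\tau_p}$ are $\mathcal{CN}(0,\sigma_p^2)$, $\sigma_p>0$. It forms $\mathbf y_{p,mk}=\mathbf Y_{p,m}\varphi_k^*$ and the LMMSE estimate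 $$\hat{\mathbf g}_{mk}=\mathbb E[\mathbf g_{mk}\mathbf y_{p,mk}^H]\,\bigl(\mathbb E[\mathbf y_{p,mk}\mathbf y_{p,mk}^H]\bigr)^{-1}\mathbf y_{p,mk}.$$ **Data.** For $1\le n\le\tau_u$, AP $m$ receives $\mathbf y_m[n]=\sum_{k}\sqrt{\rho_u\eta_k}\,\mathbf g_{mk}q_k[n]+\mathbf w_m[n]$, where $\rho_u>0$, $0\le\eta_k\le1$, $q_k[n]\sim\mathcal{CN}(0,1)$, and the entries of $\mathbf w_m[n]$ are $\mathcal{CN}(0,\sigma_w^2)$, $\sigma_w>0$. All the entries of the $\mathbf h_{mk}$, $\mathbf W_{p,m}$, $\mathbf w_m[n]$ and all the $q_k[n]$ are mutually independent. With conjugate beamforming and AP connection coefficients $c_{mk}\in\{0,1\}$, user $k$ is decoded from $$r_k[n]=\sum_{m=1}^M c_{mk}\hat{\mathbf g}_{mk}^H\mathbf y_m[n],\qquad 1\le n\le\tau_u .$$ Define $f_{k,k'}=\sum_{m=1}^M\sqrt{\rho_u\eta_{k'}}\,c_{mk}\hat{\mathbf g}_{mk}^H\mathbf g_{mk'}$,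 $\mathbb V[X]=\mathbb E|X-\mathbb E X|^2$, and $$D_k=\sum_{k'\ne k}\mathbb E\bigl[|f_{k,k'}|^2\bigr]+\mathbb E\Bigl[\sum_{m=1}^M\|c_{mk}\hat{\mathbf g}_{mk}^H\|^2\Bigr]\sigma_w^2 .$$ **Proposition.** Let $k$ be a user served by at least one AP, that is, $c_{mk}=1$ for some $m$. Then the random variables $f_{k,k'}$ are square-integrable, $\sum_m\|c_{mk}\hat{\mathbf g}_{mk}^H\|^2$ is integrable, $D_k>0$, the logarithm below is integrable, and the achievable rate $R_k=\frac1{\tau_u}I\bigl(q_k[1:\tau_u];r_k[1:\tau_u]\bigr)$, where $I$ is the mutual information in bits, satisfies $R_k\ge R_k^{\mathrm{Prop}}$, where $$R_k^{\mathrm{Prop}}=\mathbb E\left[\log_2\frac{|f_{k,k}|^2+\sum_{k'\ne k}|f_{k,k'}|^2+\sum_{m=1}^M\|c_{mk}\hat{\mathbf g}_{mk}^H\|^2\sigma_w^2}{D_k}\right]-\frac1{\tau_u}\log_2\left(1+\frac{\tau_u\,\mathbb V[f_{k,k}]}{D_k}\right).$$ No channel hardening is assumed. -/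

import Mathlib

open MeasureTheory ProbabilityTheory
open scoped NNReal ENNReal ComplexConjugate

noncomputable section

namespace CellFree

/-- The circularly symmetric complex Gaussian law `CN(0, v)`: independent real and imaginary parts,
each centred Gaussian with variance `v / 2`. -/
def complexGaussian (v : ℝ≥0) : Measure ℂ :=
  ((gaussianReal 0 (v / 2)).prod (gaussianReal 0 (v / 2))).map
    Complex.measurableEquivRealProd.symm

/-- The variance `E|X - E X|²` of a complex random variable. -/
def complexVariance {Ω : Type*} [MeasurableSpace Ω] (X : Ω → ℂ) (P : Measure Ω) : ℝ :=
  ∫ ω, ‖X ω - ∫ ω', X ω' ∂P‖ ^ 2 ∂P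

/-- The mutual information `I(X; Y)` in bits: the Kullback-Leibler divergence of the joint law from
the product of the marginal laws, divided by `log 2`. -/
def mutualInfo {Ω E F : Type*} [MeasurableSpace Ω] [MeasurableSpace E] [MeasurableSpace F]
    (X : Ω → E) (Y : Ω → F) (P : Measure Ω) : ℝ≥0∞ :=
  InformationTheory.klDiv (P.map fun ω => (X ω, Y ω)) ((P.map X).prod (P.map Y)) /
    ENNReal.ofReal (Real.log 2)

/-- The deterministic parameters of an uplink network with `M` access points,
`K` single-antenna users and `τp` training samples. -/
structure Network (M K τp : ℕ) where
  /-- large-scale fading coefficients -/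
  β : Fin M → Fin K → ℝ
  β_pos : ∀ m k, 0 < β m k
  /-- orthonormal pilot sequences: `ψ i t` is the `t`-th entry of the `i`-th sequence -/
  ψ : Fin τp → Fin τp → ℂ
  ψ_orthonormal : ∀ i j, ∑ t, ψ i t * conj (ψ j t) = if i = j then 1 else 0
  /-- index of the pilot sequence used by each user; there is no pilot contamination -/
  pilot : Fin K → Fin τp
  pilot_injective : Function.Injective pilot
  /-- transmit power in the training phase -/
  ρp : ℝ
  ρp_pos : 0 < ρp
  /-- maximum transmit power in the data phase -/
  ρu : ℝ
  ρu_pos : 0 < ρu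
  /-- power control coefficients -/
  η : Fin K → ℝ
  η_mem : ∀ k, η k ∈ Set.Icc (0 : ℝ) 1
  /-- standard deviation of the noise in the training phase -/
  σp : ℝ≥0
  σp_pos : 0 < σp
  /-- standard deviation of the noise in the data phase -/
  σw : ℝ≥0
  σw_pos : 0 < σw
  /-- connection coefficients: `c m k = 1` if access point `m` serves user `k`, else `0` -/
  c : Fin M → Fin K → ℝ
  c_mem : ∀ m k, c m k = 0 ∨ c m k = 1

/-- The primitive random variables in one coherence interval with `τu` uplink data samples. -/
structure Sources (Ω : Type*) (M N K τp τu : ℕ) where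
  /-- small-scale fading: antenna `a` of access point `m`, user `k` -/
  h : Fin M → Fin K → Fin N → Ω → ℂ
  /-- training noise: antenna `a` of access point `m`, training sample `t` -/
  W : Fin M → Fin N → Fin τp → Ω → ℂ
  /-- data symbols: user `k`, data sample `n` -/
  q : Fin K → Fin τu → Ω → ℂ
  /-- data noise: antenna `a` of access point `m`, data sample `n` -/
  w : Fin M → Fin τu → Fin N → Ω → ℂ

variable {Ω : Type*} [MeasurableSpace Ω] {M N K τp τu : ℕ}

/-- All primitive random variables as one family. -/
def Sources.all (S : Sources Ω M N K τp τu) :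
    (Fin M × Fin K × Fin N) ⊕ (Fin M × Fin N × Fin τp) ⊕ (Fin K × Fin τu) ⊕
      (Fin M × Fin τu × Fin N) → Ω → ℂ :=
  Sum.elim (fun x => S.h x.1 x.2.1 x.2.2) <|
    Sum.elim (fun x => S.W x.1 x.2.1 x.2.2) <|
      Sum.elim (fun x => S.q x.1 x.2) (fun x => S.w x.1 x.2.1 x.2.2)

/-- Rayleigh fading, Gaussian symbols and white Gaussian noise, all mutually independent. -/
structure IsModel (net : Network M K τp) (S : Sources Ω M N K τp τu) (P : Measure Ω) :
    Prop where
  law_h : ∀ m k a, HasLaw (S.h m k a) (complexGaussian 1) P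
  law_W : ∀ m a t, HasLaw (S.W m a t) (complexGaussian (net.σp ^ 2)) P
  law_q : ∀ k n, HasLaw (S.q k n) (complexGaussian 1) P
  law_w : ∀ m n a, HasLaw (S.w m n a) (complexGaussian (net.σw ^ 2)) P
  indep : iIndepFun S.all P

variable (net : Network M K τp) (S : Sources Ω M N K τp τu) (P : Measure Ω)

/-- The channel `g_{mk} = √β_{mk} h_{mk}`, constant over the coherence interval. -/
def channel (m : Fin M) (k : Fin K) (a : Fin N) (ω : Ω) : ℂ :=
  (√(net.β m k) : ℂ) * S.h m k a ω

/-- The transmitted pilot `φ_k = √(τp ρp) ψ_{i_k}`. -/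
def txPilot (k : Fin K) (t : Fin τp) : ℂ :=
  (√(τp * net.ρp) : ℂ) * net.ψ (net.pilot k) t

/-- The received pilot signal `Y_m = ∑ₖ g_{mk} φ_kᵀ + W_m`. -/
def rxPilot (m : Fin M) (a : Fin N) (t : Fin τp) (ω : Ω) : ℂ :=
  ∑ k, channel net S m k a ω * txPilot net k t + S.W m a t ω

/-- The projected pilot signal `y_{mk} = Y_m φ_k^*`. -/
def projPilot (m : Fin M) (k : Fin K) (a : Fin N) (ω : Ω) : ℂ :=
  ∑ t, rxPilot net S m a t ω * conj (txPilot net k t)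

/-- The LMMSE estimate `ĝ_{mk} = E[g_{mk} y_{mk}^H] (E[y_{mk} y_{mk}^H])⁻¹ y_{mk}`. -/
def estChannel (m : Fin M) (k : Fin K) (a : Fin N) (ω : Ω) : ℂ :=
  let crossCorr : Matrix (Fin N) (Fin N) ℂ := Matrix.of fun b d =>
    ∫ ω', channel net S m k b ω' * conj (projPilot net S m k d ω') ∂P
  let autoCorr : Matrix (Fin N) (Fin N) ℂ := Matrix.of fun b d =>
    ∫ ω', projPilot net S m k b ω' * conj (projPilot net S m k d ω') ∂P
  Matrix.mulVec (crossCorr * autoCorr⁻¹) (fun b => projPilot net S m k b ω) a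

/-- The transmitted data signal `x_k[n] = √(ρu η_k) q_k[n]`. -/
def txData (k : Fin K) (n : Fin τu) (ω : Ω) : ℂ :=
  (√(net.ρu * net.η k) : ℂ) * S.q k n ω

/-- The received data signal `y_m[n] = ∑ₖ g_{mk} x_k[n] + w_m[n]`. -/
def rxData (m : Fin M) (n : Fin τu) (a : Fin N) (ω : Ω) : ℂ :=
  ∑ k, channel net S m k a ω * txData net S k n ω + S.w m n a ω

/-- The signal `r_k[n] = ∑ₘ c_{mk} ĝ_{mk}^H y_m[n]` from which user `k` is decoded. -/
def rxCPU (k : Fin K) (n : Fin τu) (ω : Ω) : ℂ :=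
  ∑ m, (net.c m k : ℂ) * ∑ a, conj (estChannel net S P m k a ω) * rxData net S m n a ω

/-- The achievable rate `R_k = (1 / τu) I(q_k[1:τu]; r_k[1:τu])`. -/
def rate (k : Fin K) : ℝ≥0∞ :=
  mutualInfo (fun ω n => S.q k n ω) (fun ω n => rxCPU net S P k n ω) P / (τu : ℝ≥0∞)

/-- The effective channel `f_{k,k'} = ∑ₘ √(ρu η_{k'}) c_{mk} ĝ_{mk}^H g_{mk'}`. -/
def effChannel (k k' : Fin K) (ω : Ω) : ℂ :=
  ∑ m, (√(net.ρu * net.η k') : ℂ) * (net.c m k : ℂ) *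
    ∑ a, conj (estChannel net S P m k a ω) * channel net S m k' a ω

/-- The noise gain `∑ₘ |c_{mk} ĝ_{mk}^H|²`. -/
def noiseGain (k : Fin K) (ω : Ω) : ℝ :=
  ∑ m, ∑ a, ‖(net.c m k : ℂ) * conj (estChannel net S P m k a ω)‖ ^ 2

/-- The mean interference plus noise power `∑_{k' ≠ k} E|f_{k,k'}|² + E[∑ₘ |c_{mk} ĝ_{mk}^H|²] σw²`. -/
def meanInterference (k : Fin K) : ℝ :=
  (∑ k' ∈ Finset.univ.erase k, ∫ ω, ‖effChannel net S P k k' ω‖ ^ 2 ∂P) +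
    (∫ ω, noiseGain net S P k ω ∂P) * (net.σw : ℝ) ^ 2

/-- The random variable whose expectation is the first term of the bound. -/
def logTerm (k : Fin K) (ω : Ω) : ℝ :=
  Real.logb 2
    ((‖effChannel net S P k k ω‖ ^ 2 +
        ∑ k' ∈ Finset.univ.erase k, ‖effChannel net S P k k' ω‖ ^ 2 +
        noiseGain net S P k ω * (net.σw : ℝ) ^ 2) /
      meanInterference net S P k)

/-- The lower bound `R_k^Prop`. -/
def rateProp (k : Fin K) : ℝ :=
  (∫ ω, logTerm net S P k ω ∂P) -
    1 / (τu : ℝ) *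
      Real.logb 2 (1 + τu * complexVariance (effChannel net S P k k) P /
        meanInterference net S P k)

end CellFree

end

/-! Given the channels and their estimates, the processed signal over the block is `r = f q + √s ξ`.
Here `f` is the gain of user `k`, and `s` (`residualPower`, with mean `D`) is the interference plus
noise power. The vectors `q` and `ξ` are independent standard complex Gaussians, independent of the
pair `(f, s)`. No independence between `f` and `s` is needed. The proposition is thus a statement
about a block-fading channel whose state is unknown to the receiver, `ofReal_le_klDiv_fadingOutput`,
with block length `τ = τu`.

That bound is variational: `∫ φ dμ ≤ klDiv μ ν` whenever `∫ exp φ dν ≤ 1`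
(`ofReal_integral_le_klDiv`). The test function is `φ(q, y) = log p(y | q) - log g(y)`. Here `g` is
the true output density, and `p(· | q)` is the Gaussian density with mean `(E f) q` and covariance
`Σ = D I + V q qᴴ`, where `V` is the variance of `f`. This `Σ` is the true conditional covariance of
the output given `q`, although the conditional law need not be Gaussian.

Three estimates give the value of `∫ φ dμ`. The output is a mixture of `CN(0, (|f|² + s) I)`, so its
entropy is at least the mean entropy of the components, `τ (log π + E log(|f|² + s)) + τ`
(`integrable_log_mixturePDF_and_integral_le`). The quadratic form in `log p` has mean `-τ`, the
trace of `Σ⁻¹ Σ` up to sign (`integrable_rankOneExponent_and_integral`). The determinant contributes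
`-E log(1 + V ‖q‖² / D) ≥ -log(1 + τ V / D)`, by concavity. The two terms `τ` cancel.

On the network side, the estimate is a nonzero multiple of a Gaussian
(`IsModel.exists_estChannel_eq`). This gives all moments, positivity of `s`, and integrability of
the logarithm. -/

noncomputable section

namespace CellFree

/-! ### Complex Gaussian laws: linear combinations, densities, moments -/

instance isProbabilityMeasure_complexGaussian (v : ℝ≥0) :
    IsProbabilityMeasure (complexGaussian v) :=
  Measure.isProbabilityMeasure_map Complex.measurableEquivRealProd.symm.measurable.aemeasurable

lemma charFun_complexGaussian (v : ℝ≥0) (t : ℂ) :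
    charFun (complexGaussian v) t = Complex.exp (-(v * ‖t‖ ^ 2 / 4 : ℝ)) := by
  have h : ∀ x : ℝ × ℝ,
      Complex.exp (inner ℝ (Complex.measurableEquivRealProd.symm x) t * Complex.I) =
        Complex.exp (inner ℝ x.1 t.re * Complex.I) *
          Complex.exp (inner ℝ x.2 t.im * Complex.I) := by
    intro x
    rw [← Complex.exp_add]
    congr 1
    rw [Complex.measurableEquivRealProd_symm_apply, Complex.inner]
    simp
    ring
  rw [complexGaussian, charFun_apply, integral_map_equiv]
  simp_rw [h]
  rw [integral_prod_mul (fun x : ℝ => Complex.exp (inner ℝ x t.re * Complex.I))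
    (fun x : ℝ => Complex.exp (inner ℝ x t.im * Complex.I)), ← charFun_apply, ← charFun_apply,
    charFun_gaussianReal, charFun_gaussianReal, ← Complex.exp_add]
  congr 1
  rw [← Complex.normSq_eq_norm_sq, Complex.normSq_apply]
  push_cast
  ring

lemma inner_mul_left_eq_inner_conj_mul (c x t : ℂ) :
    inner ℝ (c * x) t = inner ℝ x (conj c * t) := by
  simp [Complex.inner]
  ring

/-- Sums of independent complex Gaussians over the disjoint fibres of `b` are again independent
complex Gaussians. -/
lemma map_pi_complexGaussian_blockSum {κ ι : Type*} [Fintype κ] [Fintype ι] [DecidableEq ι]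
    (v : κ → ℝ≥0) (b : κ → ι) (c : κ → ℂ) :
    (Measure.pi fun i => complexGaussian (v i)).map
        (fun x n => ∑ i with b i = n, c i * x i) =
      Measure.pi fun n => complexGaussian (∑ i with b i = n, ‖c i‖₊ ^ 2 * v i) := by
  have hm : Measurable (fun (x : κ → ℂ) n => ∑ i with b i = n, c i * x i) := by fun_prop
  have := Measure.isProbabilityMeasure_map
    (μ := Measure.pi fun i => complexGaussian (v i)) hm.aemeasurable
  rw [← charFun_eq_pi_iff]
  intro t
  -- Each index `i` lies in exactly one fibre, so the phase of the block sums is a product of phases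
  -- in the single `x i`, at frequency `conj (c i) * t (b i)`. The integral then factors over the
  -- product measure.
  have h : ∀ x : κ → ℂ,
      Complex.exp (inner ℝ (WithLp.toLp 2 fun n => ∑ i with b i = n, c i * x i) t * Complex.I) =
        ∏ i, Complex.exp (inner ℝ (x i) (conj (c i) * t (b i)) * Complex.I) := by
    intro x
    rw [← Complex.exp_sum, PiLp.inner_apply]
    congr 1
    simp only [sum_inner, inner_mul_left_eq_inner_conj_mul]
    rw [← Finset.sum_mul, ← Finset.sum_fiberwise (s := Finset.univ) (g := b)]
    push_cast
    congr 1
    refine Finset.sum_congr rfl fun n _ => Finset.sum_congr rfl fun i hi => ?_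
    rw [(Finset.mem_filter.1 hi).2]
  rw [charFun_apply, ← MeasurableEquiv.coe_toLp, integral_map_equiv, integral_map hm.aemeasurable
    (by fun_prop)]
  simp only [MeasurableEquiv.coe_toLp, h]
  rw [integral_fintype_prod_eq_prod
    (f := fun i x => Complex.exp (inner ℝ x (conj (c i) * t (b i)) * Complex.I))]
  simp only [← charFun_apply, charFun_complexGaussian]
  rw [← Finset.prod_fiberwise (s := Finset.univ) (g := b)]
  refine Finset.prod_congr rfl fun n _ => ?_
  rw [← Complex.exp_sum]
  congr 1
  rw [NNReal.coe_sum, Finset.sum_mul, Finset.sum_div]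
  push_cast
  rw [← Finset.sum_neg_distrib]
  refine Finset.sum_congr rfl fun i hi => ?_
  rw [(Finset.mem_filter.1 hi).2]
  simp
  ring

lemma hasLaw_sum_mul_complexGaussian {Ω κ : Type*} [MeasurableSpace Ω] {P : Measure Ω} [Fintype κ]
    {X : κ → Ω → ℂ} {v : κ → ℝ≥0} (hX : ∀ i, HasLaw (X i) (complexGaussian (v i)) P)
    (h : iIndepFun X P) (c : κ → ℂ) :
    HasLaw (fun ω => ∑ i, c i * X i ω) (complexGaussian (∑ i, ‖c i‖₊ ^ 2 * v i)) P := by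
  have h1 : HasLaw (fun x : κ → ℂ => ∑ i, c i * x i)
      (complexGaussian (∑ i, ‖c i‖₊ ^ 2 * v i)) (Measure.pi fun i => complexGaussian (v i)) := by
    refine ⟨Measurable.aemeasurable (by fun_prop), ?_⟩
    have := congrArg (Measure.map (fun y : Unit → ℂ => y ()))
      (map_pi_complexGaussian_blockSum v (fun _ => ()) c)
    rw [Measure.map_map (by fun_prop) (by fun_prop),
      (measurePreserving_eval (fun _ : Unit => _) ()).map_eq] at this
    simpa [Function.comp_def] using this
  exact h1.comp (h.hasLaw_pi hX)

lemma complexGaussian_map_const_mul (v : ℝ≥0) (c : ℂ) :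
    (complexGaussian v).map (fun z => c * z) = complexGaussian (‖c‖₊ ^ 2 * v) := by
  have := (hasLaw_sum_mul_complexGaussian (κ := Unit) (v := fun _ => v)
    (X := fun _ (z : ℂ) => z) (P := complexGaussian v)
    (fun _ => .id) (iIndepFun.of_subsingleton) (fun _ => c)).map_eq
  simpa using this

/-- The density of `CN(0, v)`. -/
def complexGaussianPDF (v : ℝ) (z : ℂ) : ℝ := (Real.pi * v)⁻¹ * Real.exp (-(‖z‖ ^ 2 / v))

lemma complexGaussianPDF_pos {v : ℝ} (hv : 0 < v) (z : ℂ) : 0 < complexGaussianPDF v z := by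
  unfold complexGaussianPDF; positivity

@[fun_prop]
lemma measurable_complexGaussianPDF : Measurable (fun p : ℝ × ℂ => complexGaussianPDF p.1 p.2) := by
  unfold complexGaussianPDF; fun_prop

lemma complexGaussian_eq_withDensity {v : ℝ≥0} (hv : v ≠ 0) :
    complexGaussian v = volume.withDensity fun z => ENNReal.ofReal (complexGaussianPDF v z) := by
  have hv2 : v / 2 ≠ 0 := by simpa using hv
  have e : ∀ x y : ℝ, gaussianPDF 0 (v / 2) x * gaussianPDF 0 (v / 2) y =
      ENNReal.ofReal (complexGaussianPDF v ⟨x, y⟩) := by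
    intro x y
    have hv' : (0 : ℝ) < v := by positivity
    rw [gaussianPDF, gaussianPDF, ← ENNReal.ofReal_mul (gaussianPDFReal_nonneg _ _ _)]
    congr 1
    rw [gaussianPDFReal, gaussianPDFReal, complexGaussianPDF, ← Complex.normSq_eq_norm_sq,
      Complex.normSq_mk]
    have h2 : (2 * Real.pi * ((v / 2 : ℝ≥0) : ℝ)) = Real.pi * v := by push_cast; ring
    rw [h2, mul_mul_mul_comm, ← Real.exp_add, ← mul_inv, Real.mul_self_sqrt (by positivity)]
    congr 2
    push_cast
    field_simp
    ring
  have hvol : (volume : Measure ℂ) =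
      (volume : Measure (ℝ × ℝ)).map Complex.measurableEquivRealProd.symm :=
    (Complex.volume_preserving_equiv_real_prod.symm _).map_eq.symm
  rw [complexGaussian, gaussianReal_of_var_ne_zero _ hv2, prod_withDensity
    (measurable_gaussianPDF _ _) (measurable_gaussianPDF _ _), hvol]
  ext s hs
  rw [MeasurableEquiv.map_apply, withDensity_apply _ (by measurability),
    withDensity_apply _ hs, MeasurableEquiv.restrict_map, lintegral_map_equiv]
  simp only [e]
  rfl

lemma lintegral_complexGaussianPDF {v : ℝ} (hv : 0 < v) :
    ∫⁻ z, ENNReal.ofReal (complexGaussianPDF v z) = 1 := by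
  lift v to ℝ≥0 using hv.le
  have := measure_univ (μ := complexGaussian v)
  rwa [complexGaussian_eq_withDensity (by simpa using hv.ne'), withDensity_apply _ .univ,
    Measure.restrict_univ] at this

lemma integrable_complexGaussianPDF {v : ℝ} (hv : 0 < v) :
    Integrable (complexGaussianPDF v) := by
  refine ⟨by fun_prop, ?_⟩
  rw [hasFiniteIntegral_iff_ofReal (.of_forall fun z => (complexGaussianPDF_pos hv z).le),
    lintegral_complexGaussianPDF hv]
  simp

/-- The density of the law of independent `CN(0, v)` variables. -/
def complexGaussianVecPDF {ι : Type*} [Fintype ι] (v : ℝ) (z : ι → ℂ) : ℝ :=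
  ∏ n, complexGaussianPDF v (z n)

@[fun_prop]
lemma measurable_complexGaussianVecPDF {ι : Type*} [Fintype ι] :
    Measurable (fun p : ℝ × (ι → ℂ) => complexGaussianVecPDF p.1 p.2) := by
  unfold complexGaussianVecPDF complexGaussianPDF; fun_prop

lemma complexGaussianVecPDF_pos {ι : Type*} [Fintype ι] {v : ℝ} (hv : 0 < v) (z : ι → ℂ) :
    0 < complexGaussianVecPDF v z :=
  Finset.prod_pos fun _ _ => complexGaussianPDF_pos hv _

lemma complexGaussianVecPDF_eq {ι : Type*} [Fintype ι] (v : ℝ) (z : ι → ℂ) :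
    complexGaussianVecPDF v z =
      (Real.pi * v)⁻¹ ^ Fintype.card ι * Real.exp (-((∑ n, ‖z n‖ ^ 2) / v)) := by
  simp only [complexGaussianVecPDF, complexGaussianPDF]
  rw [Finset.prod_mul_distrib, ← Real.exp_sum, Finset.sum_neg_distrib, Finset.sum_div]
  simp

lemma pi_complexGaussian_eq_withDensity {ι : Type*} [Fintype ι] {v : ℝ≥0} (hv : v ≠ 0) :
    Measure.pi (fun _ : ι => complexGaussian v) =
      volume.withDensity fun z => ENNReal.ofReal (complexGaussianVecPDF v z) := by
  have hv' : (0 : ℝ) < v := by positivity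
  refine Measure.pi_eq fun s hs => ?_
  rw [withDensity_apply _ (.univ_pi hs), volume_pi, Measure.restrict_pi_pi]
  have hint : ∀ i, Integrable (complexGaussianPDF v) (volume.restrict (s i)) := fun i =>
    (integrable_complexGaussianPDF hv').restrict
  simp only [complexGaussianVecPDF]
  rw [← ofReal_integral_eq_lintegral_ofReal
    (Integrable.fintype_prod (f := fun _ => complexGaussianPDF v) hint)
    (.of_forall fun z => (complexGaussianVecPDF_pos hv' z).le),
    integral_fintype_prod_eq_prod (f := fun _ => complexGaussianPDF v),
    ENNReal.ofReal_prod_of_nonneg fun i _ =>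
      integral_nonneg fun z => (complexGaussianPDF_pos hv' z).le]
  refine Finset.prod_congr rfl fun i _ => ?_
  rw [ofReal_integral_eq_lintegral_ofReal (hint i)
    (.of_forall fun z => (complexGaussianPDF_pos hv' z).le), complexGaussian_eq_withDensity hv,
    withDensity_apply _ (hs i)]

lemma memLp_id_complexGaussian (v : ℝ≥0) {p : ℝ≥0∞} (hp : p ≠ ∞) :
    MemLp id p (complexGaussian v) := by
  have h1 : MemLp (fun x : ℝ × ℝ => (x.1 : ℂ)) p
      ((gaussianReal 0 (v / 2)).prod (gaussianReal 0 (v / 2))) :=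
    ((memLp_id_gaussianReal' p hp).comp_measurePreserving measurePreserving_fst).ofReal
  have h2 : MemLp (fun x : ℝ × ℝ => (x.2 : ℂ)) p
      ((gaussianReal 0 (v / 2)).prod (gaussianReal 0 (v / 2))) :=
    ((memLp_id_gaussianReal' p hp).comp_measurePreserving measurePreserving_snd).ofReal
  rw [complexGaussian, memLp_map_measure_iff (by fun_prop) (by fun_prop)]
  refine (h1.add (h2.const_mul Complex.I)).ae_eq (.of_forall fun x => ?_)
  simp [Complex.measurableEquivRealProd_symm_apply, Complex.ext_iff]

lemma integral_norm_sq_complexGaussian (v : ℝ≥0) :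
    ∫ z, ‖z‖ ^ 2 ∂complexGaussian v = v := by
  have h1 : ∫ x, x ^ 2 ∂gaussianReal 0 (v / 2) = v / 2 := by
    have := variance_of_integral_eq_zero (X := fun x : ℝ => x) (μ := gaussianReal 0 (v / 2))
      (by fun_prop) (by simp)
    rw [variance_fun_id_gaussianReal] at this
    rw [← this]
    push_cast
    rfl
  have hi : Integrable (fun x => x ^ 2) (gaussianReal 0 (v / 2)) :=
    (memLp_id_gaussianReal' 2 (by simp)).integrable_sq
  rw [complexGaussian, integral_map_equiv]
  simp only [Complex.measurableEquivRealProd_symm_apply, ← Complex.normSq_eq_norm_sq,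
    Complex.normSq_mk, ← sq]
  rw [integral_add (hi.comp_fst _) (hi.comp_snd _), integral_fun_fst (fun x : ℝ => x ^ 2),
    integral_fun_snd (fun x : ℝ => x ^ 2), h1]
  simp

lemma integral_id_complexGaussian (v : ℝ≥0) : ∫ z, z ∂complexGaussian v = 0 := by
  have h := complexGaussian_map_const_mul v (-1)
  have h2 : ∫ z, z ∂complexGaussian v = ∫ z, -1 * z ∂complexGaussian v := by
    conv_lhs => rw [show complexGaussian v = (complexGaussian v).map (fun z => -1 * z) by
      rw [h]; simp]
    rw [integral_map (by fun_prop) (by fun_prop)]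
  rw [integral_const_mul] at h2
  linear_combination h2 / 2

/-! ### Variational bound on the divergence -/

/-- Integrate `X ≤ exp X - 1`. This form of Jensen's inequality serves both the variational bound
and the entropy comparison for mixtures. -/
lemma integral_nonpos_of_lintegral_exp_le_one {α : Type*} [MeasurableSpace α] {μ : Measure α}
    [IsProbabilityMeasure μ] {X : α → ℝ} (hX : Integrable X μ)
    (h : ∫⁻ a, ENNReal.ofReal (Real.exp (X a)) ∂μ ≤ 1) : ∫ a, X a ∂μ ≤ 0 := by
  have hpos : 0 ≤ᵐ[μ] fun a => Real.exp (X a) := .of_forall fun a => (Real.exp_pos _).le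
  have he : Integrable (fun a => Real.exp (X a)) μ := by
    refine ⟨Real.measurable_exp.comp_aemeasurable hX.aemeasurable |>.aestronglyMeasurable, ?_⟩
    rw [hasFiniteIntegral_iff_ofReal hpos]
    exact h.trans_lt ENNReal.one_lt_top
  have h1 : ∫ a, Real.exp (X a) ∂μ ≤ 1 := by
    rw [integral_eq_lintegral_of_nonneg_ae hpos he.1]
    exact ENNReal.toReal_le_of_le_ofReal zero_le_one (by simpa using h)
  calc ∫ a, X a ∂μ ≤ ∫ a, (Real.exp (X a) - 1) ∂μ :=
        integral_mono hX (he.sub (integrable_const _)) fun a => by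
          have := Real.add_one_le_exp (X a)
          simp only
          linarith
    _ ≤ 0 := by
        rw [integral_sub he (integrable_const _)]
        simpa using h1

/-- The variational lower bound on the Kullback-Leibler divergence. -/
lemma ofReal_integral_le_klDiv {α : Type*} [MeasurableSpace α] {μ ν : Measure α}
    [IsProbabilityMeasure μ] [IsProbabilityMeasure ν] {φ : α → ℝ} (hm : Measurable φ)
    (hφ : Integrable φ μ) (h : ∫⁻ a, ENNReal.ofReal (Real.exp (φ a)) ∂ν ≤ 1) :
    ENNReal.ofReal (∫ a, φ a ∂μ) ≤ InformationTheory.klDiv μ ν := by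
  by_cases ht : InformationTheory.klDiv μ ν = ∞
  · simp [ht]
  obtain ⟨hac, hint⟩ := InformationTheory.klDiv_ne_top_iff.1 ht
  rw [InformationTheory.klDiv_of_ac_of_integrable hac hint]
  refine ENNReal.ofReal_le_ofReal ?_
  simp only [probReal_univ, add_sub_cancel_right]
  rw [← sub_nonpos, ← integral_sub hφ hint]
  refine integral_nonpos_of_lintegral_exp_le_one (hφ.sub hint) ?_
  -- Since `exp (-llr μ ν)` is `dν/dμ`, this is a change of measure from `μ` to the part of `ν`
  -- absolutely continuous with respect to `μ`. A singular part of `ν` only helps, hence the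
  -- inequality below.
  calc ∫⁻ a, ENNReal.ofReal (Real.exp (φ a - llr μ ν a)) ∂μ
      = ∫⁻ a, ν.rnDeriv μ a * ENNReal.ofReal (Real.exp (φ a)) ∂μ := by
        refine lintegral_congr_ae ?_
        filter_upwards [exp_neg_llr hac, ν.rnDeriv_lt_top μ] with a ha hlt
        rw [sub_eq_add_neg, Real.exp_add, show Real.exp (-llr μ ν a) = _ from ha,
          ENNReal.ofReal_mul (Real.exp_pos _).le, ENNReal.ofReal_toReal hlt.ne, mul_comm]
    _ = ∫⁻ a, ENNReal.ofReal (Real.exp (φ a)) ∂μ.withDensity (ν.rnDeriv μ) := by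
        rw [lintegral_withDensity_eq_lintegral_mul _ (ν.measurable_rnDeriv μ) (by fun_prop)]
        rfl
    _ ≤ ∫⁻ a, ENNReal.ofReal (Real.exp (φ a)) ∂ν :=
        lintegral_mono' (Measure.withDensity_rnDeriv_le _ _) le_rfl
    _ ≤ 1 := h

/-! ### Gaussian vectors and entropy of Gaussian mixtures -/

/-- The law of independent `CN(0, 1)` variables. -/
abbrev stdComplexGaussian (ι : Type*) [Fintype ι] : Measure (ι → ℂ) :=
  Measure.pi fun _ => complexGaussian 1

/-- The squared Euclidean norm on `ι → ℂ`. -/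
def sqNorm {ι : Type*} [Fintype ι] (z : ι → ℂ) : ℝ := ∑ n, ‖z n‖ ^ 2

section

variable {ι : Type*} [Fintype ι]

lemma sqNorm_nonneg (z : ι → ℂ) : 0 ≤ sqNorm z := Finset.sum_nonneg fun _ _ => by positivity

@[fun_prop]
lemma measurable_sqNorm : Measurable (sqNorm : (ι → ℂ) → ℝ) := by
  unfold sqNorm; fun_prop

lemma sqNorm_smul (c : ℂ) (z : ι → ℂ) : sqNorm (c • z) = ‖c‖ ^ 2 * sqNorm z := by
  simp [sqNorm, mul_pow, Finset.mul_sum]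

lemma integrable_norm_sq_eval (n : ι) :
    Integrable (fun z => ‖z n‖ ^ 2) (stdComplexGaussian ι) :=
  ((memLp_id_complexGaussian 1 (p := 2) (by simp)).comp_measurePreserving
    (measurePreserving_eval (fun _ : ι => complexGaussian 1) n)).integrable_norm_pow (by simp)

lemma integrable_sqNorm : Integrable sqNorm (stdComplexGaussian ι) :=
  integrable_finsetSum _ fun n _ => integrable_norm_sq_eval n

lemma integral_sqNorm : ∫ z, sqNorm z ∂stdComplexGaussian ι = Fintype.card ι := by
  unfold sqNorm
  rw [integral_finsetSum _ fun n _ => integrable_norm_sq_eval n]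
  have : ∀ n : ι, ∫ z, ‖z n‖ ^ 2 ∂stdComplexGaussian ι = 1 := fun n => by
    have := integral_map (μ := stdComplexGaussian ι) (φ := fun z => z n)
      (f := fun z : ℂ => ‖z‖ ^ 2) (measurable_pi_apply n).aemeasurable (by fun_prop)
    rw [← this, (measurePreserving_eval (fun _ : ι => complexGaussian 1) n).map_eq,
      integral_norm_sq_complexGaussian]
    simp
  simp [this]

lemma log_complexGaussianVecPDF {v : ℝ} (hv : 0 < v) (z : ι → ℂ) :
    Real.log (complexGaussianVecPDF v z) =
      -(Fintype.card ι * Real.log (Real.pi * v)) - sqNorm z / v := by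
  rw [complexGaussianVecPDF_eq, Real.log_mul (by positivity) (Real.exp_ne_zero _), Real.log_exp,
    Real.log_pow, Real.log_inv, sqNorm]
  ring

lemma stdComplexGaussian_map_smul (T : ℝ) (hT : 0 < T) :
    (stdComplexGaussian ι).map (fun z => (√T : ℂ) • z) =
      volume.withDensity fun z => ENNReal.ofReal (complexGaussianVecPDF T z) := by
  lift T to ℝ≥0 using hT.le
  have hT' : T ≠ 0 := by simpa using hT.ne'
  rw [← pi_complexGaussian_eq_withDensity hT']
  have h : (complexGaussian 1).map (fun z => ((√(T : ℝ) : ℝ) : ℂ) * z) = complexGaussian T := by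
    rw [complexGaussian_map_const_mul]
    congr 1
    ext
    simp
  have := Measure.pi_map_pi (μ := fun _ : ι => complexGaussian 1)
    (f := fun _ z => ((√(T : ℝ) : ℝ) : ℂ) * z) (hμ := fun _ => by rw [h]; infer_instance)
    (fun _ => by fun_prop)
  rw [h] at this
  exact this

variable {Ω : Type*} [MeasurableSpace Ω] (ρ : Measure Ω) (T : Ω → ℝ)

/-- The density of a Gaussian mixture with random variance `T`. -/
def mixturePDF (x : ι → ℂ) : ℝ≥0∞ := ∫⁻ ω, ENNReal.ofReal (complexGaussianVecPDF (T ω) x) ∂ρ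

variable {ρ T}

lemma lintegral_mixture (hTm : Measurable T) (hT : ∀ᵐ ω ∂ρ, 0 < T ω)
    {F : Ω → (ι → ℂ) → ℝ≥0∞} (hF : Measurable (Function.uncurry F)) :
    ∫⁻ p, F p.1 ((√(T p.1) : ℂ) • p.2) ∂ρ.prod (stdComplexGaussian ι) =
      ∫⁻ ω, (∫⁻ x, ENNReal.ofReal (complexGaussianVecPDF (T ω) x) * F ω x) ∂ρ := by
  rw [lintegral_prod _ (by
    exact (hF.comp (f := fun p : Ω × (ι → ℂ) => (p.1, (√(T p.1) : ℂ) • p.2))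
      (by fun_prop)).aemeasurable)]
  refine lintegral_congr_ae (hT.mono fun ω hω => ?_)
  have hFω : Measurable (F ω) := hF.comp measurable_prodMk_left
  simp only
  rw [← lintegral_map (f := F ω) (g := fun z => (√(T ω) : ℂ) • z) hFω (by fun_prop),
    stdComplexGaussian_map_smul _ hω, lintegral_withDensity_eq_lintegral_mul _ (by fun_prop) hFω]
  rfl

variable [IsProbabilityMeasure ρ]

lemma measurable_mixturePDF (hTm : Measurable T) :
    Measurable (mixturePDF ρ T : (ι → ℂ) → ℝ≥0∞) := by
  unfold mixturePDF
  exact Measurable.lintegral_prod_left' (f := fun p : Ω × (ι → ℂ) =>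
    ENNReal.ofReal (complexGaussianVecPDF (T p.1) p.2)) (by fun_prop)

lemma map_mixture_eq_withDensity (hTm : Measurable T) (hT : ∀ᵐ ω ∂ρ, 0 < T ω) :
    (ρ.prod (stdComplexGaussian ι)).map (fun p => (√(T p.1) : ℂ) • p.2) =
      volume.withDensity (mixturePDF ρ T) := by
  ext s hs
  rw [← lintegral_indicator_one hs, lintegral_map (by measurability) (by fun_prop),
    lintegral_mixture hTm hT (F := fun _ x => s.indicator 1 x)
      ((measurable_one.indicator hs).comp measurable_snd),
    lintegral_lintegral_swap (Measurable.aemeasurable (by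
      refine Measurable.mul (by fun_prop) ((measurable_one.indicator hs).comp measurable_snd))),
    withDensity_apply _ hs, ← lintegral_indicator hs]
  refine lintegral_congr fun x => ?_
  by_cases hx : x ∈ s <;> simp [hx, mixturePDF]

lemma lintegral_mixturePDF (hTm : Measurable T) (hT : ∀ᵐ ω ∂ρ, 0 < T ω) :
    ∫⁻ x, mixturePDF ρ T x ∂(volume : Measure (ι → ℂ)) = 1 := by
  have h := congrArg (fun μ : Measure (ι → ℂ) => μ Set.univ) (map_mixture_eq_withDensity hTm hT)
  simp only [withDensity_apply _ MeasurableSet.univ, Measure.restrict_univ] at h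
  rw [← h, Measure.map_apply (by fun_prop) .univ]
  simp

/-- As `T > 0` almost surely, `T` stays in some `[1/(n+1), n+1]` with positive probability, and the
components with such `T` already give a Gaussian minorant. It bounds the log-density of the mixture
from below by a quadratic, which makes its entropy integrable. -/
lemma exists_le_mixturePDF (hTm : Measurable T) (hT : ∀ᵐ ω ∂ρ, 0 < T ω) :
    ∃ a c : ℝ, 0 < a ∧ 0 < c ∧
    ∀ x : ι → ℂ, ENNReal.ofReal (c * Real.exp (-(sqNorm x / a))) ≤ mixturePDF ρ T x := by
  have hne : ρ (⋃ n : ℕ, {ω | 1 / ((n : ℝ) + 1) ≤ T ω ∧ T ω ≤ n + 1}) ≠ 0 := by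
    rw [measure_congr (t := Set.univ)]
    · simp
    filter_upwards [hT] with ω hω
    refine eq_true ?_ |>.trans (eq_true trivial).symm
    obtain ⟨n₁, h₁⟩ := exists_nat_one_div_lt hω
    obtain ⟨n₂, h₂⟩ := exists_nat_ge (T ω)
    refine Set.mem_iUnion.2 ⟨max n₁ n₂, ?_, ?_⟩
    · refine le_trans ?_ h₁.le
      gcongr
      exact le_max_left _ _
    · refine h₂.trans (le_trans ?_ (le_add_of_nonneg_right zero_le_one))
      exact_mod_cast le_max_right _ _
  obtain ⟨n, hn⟩ := exists_measure_pos_of_not_measure_iUnion_null hne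
  set A := {ω | 1 / ((n : ℝ) + 1) ≤ T ω ∧ T ω ≤ n + 1} with hA
  have hAr : 0 < ρ.real A := ENNReal.toReal_pos hn.ne' (measure_ne_top _ _)
  -- The smallest admissible variance goes into the exponent and the largest into the prefactor, so
  -- that both bound the component density from below.
  refine ⟨1 / ((n : ℝ) + 1), (Real.pi * (n + 1))⁻¹ ^ Fintype.card ι * ρ.real A,
    by positivity, by positivity, fun x => ?_⟩
  set C : ℝ := (Real.pi * (n + 1))⁻¹ ^ Fintype.card ι * Real.exp (-(sqNorm x / (1 / ((n : ℝ) + 1))))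
    with hC
  calc _ = ENNReal.ofReal C * ρ A := by
        rw [mul_right_comm, ENNReal.ofReal_mul (by positivity), ofReal_measureReal]
    _ ≤ ENNReal.ofReal C * ρ {ω | ENNReal.ofReal C ≤
          ENNReal.ofReal (complexGaussianVecPDF (T ω) x)} := by
        gcongr
        rintro ω ⟨h₁, h₂⟩
        have h0 : 0 < T ω := lt_of_lt_of_le (by positivity) h₁
        refine ENNReal.ofReal_le_ofReal ?_
        rw [complexGaussianVecPDF_eq, ← sqNorm, hC]
        gcongr
        exact sqNorm_nonneg x
    _ ≤ _ := mul_meas_ge_le_lintegral₀ (Measurable.aemeasurable (by fun_prop)) _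

/-- A Gaussian mixture has at least the mean differential entropy of its components. -/
lemma integrable_log_mixturePDF_and_integral_le (hTm : Measurable T) (hT : ∀ᵐ ω ∂ρ, 0 < T ω)
    (hTi : Integrable T ρ) (hTl : Integrable (fun ω => Real.log (T ω)) ρ) :
    Integrable (fun p : Ω × (ι → ℂ) =>
      Real.log (mixturePDF ρ T ((√(T p.1) : ℂ) • p.2)).toReal)
        (ρ.prod (stdComplexGaussian ι)) ∧
    ∫ p, Real.log (mixturePDF ρ T ((√(T p.1) : ℂ) • p.2)).toReal
        ∂ρ.prod (stdComplexGaussian ι) ≤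
      -(Fintype.card ι * (Real.log Real.pi + ∫ ω, Real.log (T ω) ∂ρ)) - Fintype.card ι := by
  set Q := ρ.prod (stdComplexGaussian ι) with hQ
  set r : Ω × (ι → ℂ) → (ι → ℂ) := fun p => (√(T p.1) : ℂ) • p.2 with hr
  have hrm : Measurable r := by fun_prop
  have hpm := measurable_mixturePDF (ι := ι) (ρ := ρ) hTm
  have hTQ : ∀ᵐ p ∂Q, 0 < T p.1 := Measure.quasiMeasurePreserving_fst.ae hT
  have hrn : ∀ᵐ p ∂Q, sqNorm (r p) = T p.1 * sqNorm p.2 := hTQ.mono fun p hp => by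
    simp only [hr, sqNorm_smul]
    simp [Real.sq_sqrt hp.le]
  -- the log-density of the component
  set ℓ : Ω × (ι → ℂ) → ℝ := fun p => Real.log (complexGaussianVecPDF (T p.1) (r p)) with hℓ
  have hℓeq : ℓ =ᵐ[Q] fun p => -(Fintype.card ι * (Real.log Real.pi + Real.log (T p.1))) -
      sqNorm p.2 := by
    filter_upwards [hTQ, hrn] with p hp hp'
    simp only [hℓ, log_complexGaussianVecPDF hp, hp', Real.log_mul Real.pi_ne_zero hp.ne']
    field_simp
  have hTl' : Integrable (fun p : Ω × (ι → ℂ) => Real.log (T p.1)) Q := hTl.comp_fst _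
  have hs' : Integrable (fun p : Ω × (ι → ℂ) => sqNorm p.2) Q := integrable_sqNorm.comp_snd _
  have hℓi₁ : Integrable (fun p : Ω × (ι → ℂ) =>
      -(Fintype.card ι * (Real.log Real.pi + Real.log (T p.1)))) Q :=
    (((integrable_const _).add hTl').const_mul _).neg
  have hℓi : Integrable ℓ Q := (hℓi₁.sub hs').congr hℓeq.symm
  have hℓint : ∫ p, ℓ p ∂Q =
      -(Fintype.card ι * (Real.log Real.pi + ∫ ω, Real.log (T ω) ∂ρ)) - Fintype.card ι := by
    rw [integral_congr_ae hℓeq, integral_sub hℓi₁ hs', integral_neg, integral_const_mul,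
      integral_add (integrable_const _) hTl', hQ, integral_fun_fst (fun ω => Real.log (T ω)),
      integral_fun_snd sqNorm, integral_sqNorm]
    simp
  -- the likelihood ratio
  set u : Ω × (ι → ℂ) → ℝ≥0∞ := fun p =>
    mixturePDF ρ T (r p) / ENNReal.ofReal (complexGaussianVecPDF (T p.1) (r p)) with hu
  have hum : Measurable u := by fun_prop
  -- Conditionally on `ω` the component density cancels and the mixture density integrates to one.
  -- With the logarithm of `u` having nonpositive mean, this is Gibbs' inequality.
  have hu1 : ∫⁻ p, u p ∂Q = 1 := by
    rw [hu, hQ, lintegral_mixture hTm hT (F := fun ω x =>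
      mixturePDF ρ T x / ENNReal.ofReal (complexGaussianVecPDF (T ω) x)) (by
        unfold Function.uncurry; fun_prop)]
    rw [lintegral_congr_ae (g := fun _ => 1)]
    · simp
    filter_upwards [hT] with ω hω
    rw [← lintegral_mixturePDF (ι := ι) hTm hT]
    refine lintegral_congr fun x => ?_
    exact ENNReal.mul_div_cancel (by simpa using complexGaussianVecPDF_pos hω x)
      ENNReal.ofReal_ne_top
  have hufin : ∀ᵐ p ∂Q, u p < ∞ := ae_lt_top hum (by simp [hu1])
  have hui : Integrable (fun p => (u p).toReal) Q :=
    integrable_toReal_of_lintegral_ne_top hum.aemeasurable (by simp [hu1])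
  obtain ⟨a, c, ha, hc, hac⟩ := exists_le_mixturePDF (ι := ι) hTm hT
  have hppos : ∀ x : ι → ℂ, 0 < mixturePDF ρ T x := fun x =>
    lt_of_lt_of_le (by simpa using by positivity) (hac x)
  have hpfin : ∀ᵐ p ∂Q, mixturePDF ρ T (r p) ≠ ∞ := by
    filter_upwards [hufin] with p hp h
    simp [hu, h, ENNReal.top_div] at hp
  have hexp : ∀ᵐ p ∂Q, Real.exp (Real.log (mixturePDF ρ T (r p)).toReal - ℓ p) =
      (u p).toReal := by
    filter_upwards [hTQ, hpfin] with p hp hp'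
    have := complexGaussianVecPDF_pos hp (r p)
    rw [Real.exp_sub, Real.exp_log (ENNReal.toReal_pos (hppos _).ne' hp'), Real.exp_log this,
      ENNReal.toReal_div, ENNReal.toReal_ofReal this.le]
  have hX : Integrable (fun p => Real.log (mixturePDF ρ T (r p)).toReal - ℓ p) Q := by
    -- From below by the Gaussian minorant, from above by `log u ≤ u - 1`.
    refine integrable_of_le_of_le (g₁ := fun p => Real.log c - T p.1 * sqNorm p.2 / a - ℓ p)
      (g₂ := fun p => (u p).toReal - 1) (Measurable.aestronglyMeasurable (by fun_prop)) ?_ ?_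
      ?_ (hui.sub (integrable_const _))
    · filter_upwards [hpfin, hrn] with p hp hp'
      gcongr
      rw [← hp', sub_eq_add_neg, ← Real.log_exp (-(sqNorm (r p) / a)),
        ← Real.log_mul hc.ne' (Real.exp_ne_zero _)]
      refine Real.log_le_log (by positivity) ?_
      exact (ENNReal.ofReal_le_iff_le_toReal hp).1 (hac _)
    · filter_upwards [hexp] with p hp
      rw [← hp]
      have := Real.add_one_le_exp (Real.log (mixturePDF ρ T (r p)).toReal - ℓ p)
      linarith
    · exact ((integrable_const _).sub ((hTi.mul_prod integrable_sqNorm).div_const a)).sub hℓi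
  have hXle := integral_nonpos_of_lintegral_exp_le_one hX (by
    rw [lintegral_congr_ae (g := u)]
    · exact hu1.le
    filter_upwards [hexp, hufin] with p hp hp'
    rw [hp, ENNReal.ofReal_toReal hp'.ne])
  have hL : Integrable (fun p => Real.log (mixturePDF ρ T (r p)).toReal) Q := by
    simpa [Pi.add_def] using hX.add hℓi
  refine ⟨hL, ?_⟩
  rw [integral_sub hL hℓi, hℓint] at hXle
  linarith

end

/-! ### Gaussian density with rank-one perturbed covariance -/

section

variable {ι : Type*} [Fintype ι]

/-- The inner product `∑ n, u n * conj (q n)`. -/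
def corr (u q : ι → ℂ) : ℂ := ∑ n, u n * conj (q n)

@[fun_prop]
lemma measurable_corr : Measurable (fun p : (ι → ℂ) × (ι → ℂ) => corr p.1 p.2) := by
  unfold corr; fun_prop

lemma corr_add_left (u v q : ι → ℂ) : corr (u + v) q = corr u q + corr v q := by
  simp [corr, add_mul, Finset.sum_add_distrib]

lemma corr_smul_left (c : ℂ) (u q : ι → ℂ) : corr (c • u) q = c * corr u q := by
  simp [corr, mul_assoc, Finset.mul_sum]

lemma corr_neg_left (u q : ι → ℂ) : corr (-u) q = -corr u q := by
  simp [corr]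

lemma corr_self (q : ι → ℂ) : corr q q = sqNorm q := by
  simp [corr, sqNorm, Complex.mul_conj, Complex.normSq_eq_norm_sq]

lemma norm_corr_sq_le (u q : ι → ℂ) : ‖corr u q‖ ^ 2 ≤ sqNorm u * sqNorm q := by
  calc ‖corr u q‖ ^ 2 ≤ (∑ n, ‖u n‖ * ‖q n‖) ^ 2 := by
        gcongr
        exact (norm_sum_le _ _).trans_eq (by simp)
    _ ≤ _ := Finset.sum_mul_sq_le_sq_mul_sq _ _ _

lemma sqNorm_sub_smul (u q : ι → ℂ) (c : ℂ) :
    sqNorm (u - c • q) = sqNorm u - 2 * (conj c * corr u q).re + ‖c‖ ^ 2 * sqNorm q := by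
  simp only [sqNorm, corr, Finset.mul_sum, Complex.re_sum, ← Finset.sum_sub_distrib,
    ← Finset.sum_add_distrib]
  refine Finset.sum_congr rfl fun n _ => ?_
  simp only [← Complex.normSq_eq_norm_sq, Complex.normSq_apply]
  simp
  ring

lemma sqNorm_add_add_sqNorm_sub (u v : ι → ℂ) :
    sqNorm (u + v) + sqNorm (u + -v) = 2 * (sqNorm u + sqNorm v) := by
  simp only [sqNorm, Finset.mul_sum, ← Finset.sum_add_distrib]
  refine Finset.sum_congr rfl fun n _ => ?_
  simp only [← Complex.normSq_eq_norm_sq, Complex.normSq_apply]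
  simp
  ring

/-- The density of the complex Gaussian vector with covariance matrix `D I + V q qᴴ`. -/
def rankOnePDF (D V : ℝ) (q u : ι → ℂ) : ℝ :=
  (Real.pi * D)⁻¹ ^ Fintype.card ι * (1 + V * sqNorm q / D)⁻¹ *
    Real.exp (-(sqNorm u / D) + V / (D * (D + V * sqNorm q)) * ‖corr u q‖ ^ 2)

@[fun_prop]
lemma measurable_rankOnePDF (D V : ℝ) :
    Measurable (fun p : (ι → ℂ) × (ι → ℂ) => rankOnePDF D V p.1 p.2) := by
  unfold rankOnePDF; fun_prop

variable {D V : ℝ}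

lemma rankOnePDF_pos (hD : 0 < D) (hV : 0 ≤ V) (q u : ι → ℂ) : 0 < rankOnePDF D V q u := by
  have := sqNorm_nonneg q
  unfold rankOnePDF; positivity

/-- Bayes' rule for `u = √V t q + noise` with `t ~ CN(0, 1)`: completing the square in `t` splits
the joint density into the marginal of `u` and the posterior of `t`. -/
lemma complexGaussianVecPDF_mul_complexGaussianPDF (hD : 0 < D) (hV : 0 ≤ V) (q u : ι → ℂ)
    (t : ℂ) :
    complexGaussianVecPDF D (u - (√V * t : ℂ) • q) * complexGaussianPDF 1 t =
      rankOnePDF D V q u * complexGaussianPDF (1 + V * sqNorm q / D)⁻¹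
        (t - (√V / (D + V * sqNorm q) : ℝ) * corr u q) := by
  have hq := sqNorm_nonneg q
  have hA : 0 < D + V * sqNorm q := by positivity
  rw [complexGaussianVecPDF_eq, ← sqNorm, sqNorm_sub_smul, rankOnePDF]
  simp only [complexGaussianPDF]
  have e : ∀ a b c d x y z w : ℝ, a * d = b * c → x + y = z + w →
      a * Real.exp x * (d * Real.exp y) = b * Real.exp z * (c * Real.exp w) := by
    intro a b c d x y z w h₁ h₂
    rw [mul_mul_mul_comm, ← Real.exp_add, h₁, h₂, Real.exp_add]
    ring
  refine e _ _ _ _ _ _ _ _ ?_ ?_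
  · field_simp
  · have hs := Real.mul_self_sqrt hV
    obtain ⟨κ, hκ⟩ : ∃ κ : ℝ, κ = √V / (D + V * sqNorm q) := ⟨_, rfl⟩
    rw [← hκ]
    simp only [← Complex.normSq_eq_norm_sq, Complex.normSq_apply]
    simp
    rw [hκ]
    generalize √V = w at hs ⊢
    subst hs
    field_simp
    ring

/-- As the marginal of `u` in the factorization above, this density has mass one by Tonelli; no
determinant or matrix inverse is needed. -/
lemma lintegral_rankOnePDF (hD : 0 < D) (hV : 0 ≤ V) (q : ι → ℂ) :
    ∫⁻ u, ENNReal.ofReal (rankOnePDF D V q u) = 1 := by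
  have hq := sqNorm_nonneg q
  have hA : 0 < (1 + V * sqNorm q / D)⁻¹ := by positivity
  have hmix : ∀ u, ENNReal.ofReal (rankOnePDF D V q u) =
      ∫⁻ t : ℂ, ENNReal.ofReal (complexGaussianVecPDF D (u - (√V * t : ℂ) • q)) *
        ENNReal.ofReal (complexGaussianPDF 1 t) := by
    intro u
    simp_rw [← ENNReal.ofReal_mul (complexGaussianVecPDF_pos hD _).le,
      complexGaussianVecPDF_mul_complexGaussianPDF hD hV,
      ENNReal.ofReal_mul (rankOnePDF_pos hD hV q u).le]
    rw [lintegral_const_mul _ (by fun_prop), lintegral_sub_right_eq_self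
      (fun t => ENNReal.ofReal (complexGaussianPDF (1 + V * sqNorm q / D)⁻¹ t)),
      lintegral_complexGaussianPDF hA, mul_one]
  have hvec : ∫⁻ u : ι → ℂ, ENNReal.ofReal (complexGaussianVecPDF D u) = 1 := by
    have h := congrArg (fun μ : Measure (ι → ℂ) => μ Set.univ)
      (stdComplexGaussian_map_smul (ι := ι) D hD)
    simp only [withDensity_apply _ MeasurableSet.univ, Measure.restrict_univ] at h
    rw [← h, Measure.map_apply (by fun_prop) .univ]
    simp
  calc ∫⁻ u, ENNReal.ofReal (rankOnePDF D V q u)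
      = ∫⁻ t : ℂ, ∫⁻ u : ι → ℂ, ENNReal.ofReal (complexGaussianVecPDF D (u - (√V * t : ℂ) • q)) *
          ENNReal.ofReal (complexGaussianPDF 1 t) := by
        simp_rw [hmix]
        exact lintegral_lintegral_swap (Measurable.aemeasurable (by fun_prop))
    _ = ∫⁻ t : ℂ, ENNReal.ofReal (complexGaussianPDF 1 t) := by
        refine lintegral_congr fun t => ?_
        rw [lintegral_mul_const _ (by fun_prop), lintegral_sub_right_eq_self
          (fun u : ι → ℂ => ENNReal.ofReal (complexGaussianVecPDF D u)), hvec, one_mul]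
    _ = 1 := lintegral_complexGaussianPDF one_pos

/-- The two vectors form one family over `ι ⊕ ι`; folding the two copies of `ι` together is a block
sum with variances `‖a‖² + ‖b‖²`. -/
lemma stdComplexGaussian_prod_map (a b : ℂ) (h : ‖a‖ ^ 2 + ‖b‖ ^ 2 = 1) :
    ((stdComplexGaussian ι).prod (stdComplexGaussian ι)).map (fun p => a • p.1 + b • p.2) =
      stdComplexGaussian ι := by
  classical
  have h1 := map_pi_complexGaussian_blockSum (fun _ : ι ⊕ ι => 1) (Sum.elim id id)
    (Sum.elim (fun _ => a) (fun _ => b))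
  have hfil : ∀ n : ι, ({i | Sum.elim id id i = n} : Finset (ι ⊕ ι)) = {.inl n, .inr n} := by
    intro n
    ext i
    cases i <;> simp
  have h2 : ∀ n : ι, (∑ i with Sum.elim id id i = n,
      ‖(Sum.elim (fun _ => a) (fun _ => b) : ι ⊕ ι → ℂ) i‖₊ ^ 2 * (1 : ℝ≥0)) = 1 := by
    intro n
    rw [hfil, Finset.sum_pair (by simp)]
    ext
    simp [h]
  simp only [h2] at h1
  rw [← (measurePreserving_sumPiEquivProdPi_symm fun _ : ι ⊕ ι => complexGaussian 1).map_eq,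
    Measure.map_map (measurable_pi_lambda _ fun n => by fun_prop)
      (MeasurableEquiv.measurable _)] at h1
  refine Eq.trans ?_ h1
  congr 1
  ext p n
  simp [hfil, MeasurableEquiv.sumPiEquivProdPi, Equiv.sumPiEquivProdPi]

lemma measurePreserving_neg_stdComplexGaussian :
    MeasurePreserving (fun z : ι → ℂ => -z) (stdComplexGaussian ι) (stdComplexGaussian ι) := by
  refine measurePreserving_pi _ _ fun _ => ⟨measurable_neg, ?_⟩
  simpa using complexGaussian_map_const_mul 1 (-1)

lemma integral_norm_corr_sq (q : ι → ℂ) :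
    ∫ ξ, ‖corr ξ q‖ ^ 2 ∂stdComplexGaussian ι = sqNorm q := by
  have h := hasLaw_sum_mul_complexGaussian (P := stdComplexGaussian ι) (v := fun _ => 1)
    (X := fun n (z : ι → ℂ) => z n)
    (fun n => (measurePreserving_eval (fun _ : ι => complexGaussian 1) n).hasLaw)
    (iIndepFun_pi (X := fun _ => id) (fun _ => aemeasurable_id)) (fun n => conj (q n))
  have := h.integral_comp (f := fun z => ‖z‖ ^ 2) (by fun_prop)
  rw [integral_norm_sq_complexGaussian] at this
  simpa [corr, sqNorm, mul_comm, Function.comp_def] using this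

end

/-! ### The block-fading channel -/

section

variable {ι : Type*} [Fintype ι] {Ω : Type*} [MeasurableSpace Ω] {ρ : Measure Ω}

/-- The received vector of a fading channel with gain `f`, noise variance `s`, input `q` and
normalized noise `ξ`. -/
def fadingOutput (f : Ω → ℂ) (s : Ω → ℝ) (p : Ω × (ι → ℂ) × (ι → ℂ)) : ι → ℂ :=
  f p.1 • p.2.1 + (√(s p.1) : ℂ) • p.2.2

variable {f : Ω → ℂ} {s : Ω → ℝ}

@[fun_prop]
lemma measurable_fadingOutput (hf : Measurable f) (hs : Measurable s) :
    Measurable (fadingOutput f s : Ω × (ι → ℂ) × (ι → ℂ) → ι → ℂ) := by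
  unfold fadingOutput; fun_prop

lemma fadingOutput_eq_smul (hpos : ∀ᵐ ω ∂ρ, 0 < s ω) :
    ∀ᵐ p ∂ρ.prod ((stdComplexGaussian ι).prod (stdComplexGaussian ι)), fadingOutput f s p =
      (√(‖f p.1‖ ^ 2 + s p.1) : ℂ) • (√(‖f p.1‖ ^ 2 + s p.1) : ℂ)⁻¹ • fadingOutput f s p := by
  filter_upwards [Measure.quasiMeasurePreserving_fst.ae hpos] with p hp
  have hT : 0 < ‖f p.1‖ ^ 2 + s p.1 := by positivity
  rw [smul_inv_smul₀]
  exact_mod_cast (Real.sqrt_pos.2 hT).ne'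

variable [IsProbabilityMeasure ρ]

/-- For fixed `ω`, `f q + √s ξ` has independent `CN(0, |f|² + s)` entries. Hence the normalized
output is standard and independent of `ω`, and the output is a Gaussian mixture with random variance
`|f|² + s`. -/
lemma measurePreserving_normalized_fadingOutput (hf : Measurable f) (hs : Measurable s)
    (hpos : ∀ᵐ ω ∂ρ, 0 < s ω) :
    MeasurePreserving
      (fun p : Ω × (ι → ℂ) × (ι → ℂ) =>
        (p.1, (√(‖f p.1‖ ^ 2 + s p.1) : ℂ)⁻¹ • fadingOutput f s p))
      (ρ.prod ((stdComplexGaussian ι).prod (stdComplexGaussian ι)))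
      (ρ.prod (stdComplexGaussian ι)) := by
  refine (MeasurePreserving.id ρ).skew_product
    (g := fun ω (p : (ι → ℂ) × (ι → ℂ)) =>
      (√(‖f ω‖ ^ 2 + s ω) : ℂ)⁻¹ • fadingOutput f s (ω, p)) ?_ ?_
  · unfold Function.uncurry; fun_prop
  filter_upwards [hpos] with ω hω
  refine Eq.trans ?_ (stdComplexGaussian_prod_map ((√(‖f ω‖ ^ 2 + s ω) : ℂ)⁻¹ * f ω)
    ((√(‖f ω‖ ^ 2 + s ω) : ℂ)⁻¹ * √(s ω)) ?_)
  · simp only [fadingOutput, smul_add, smul_smul]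
  · have hT : 0 < ‖f ω‖ ^ 2 + s ω := by positivity
    simp only [norm_mul, norm_inv, Complex.norm_real, Real.norm_eq_abs, mul_pow, inv_pow, sq_abs,
      Real.sq_sqrt hT.le, Real.sq_sqrt hω.le]
    field_simp

/-- The exponent of `rankOnePDF`. -/
def rankOneExponent (D V : ℝ) (q u : ι → ℂ) : ℝ :=
  -(sqNorm u / D) + V / (D * (D + V * sqNorm q)) * ‖corr u q‖ ^ 2

@[fun_prop]
lemma measurable_rankOneExponent (D V : ℝ) :
    Measurable (fun p : (ι → ℂ) × (ι → ℂ) => rankOneExponent D V p.1 p.2) := by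
  unfold rankOneExponent; fun_prop

/-- By Cauchy–Schwarz. The exponent is minus the quadratic form of the inverse of `D I + V q qᴴ`,
written out by Sherman–Morrison. -/
lemma rankOneExponent_nonpos {D V : ℝ} (hD : 0 < D) (hV : 0 ≤ V) (q u : ι → ℂ) :
    rankOneExponent D V q u ≤ 0 := by
  have hq := sqNorm_nonneg q
  have hu := sqNorm_nonneg u
  have hc := norm_corr_sq_le u q
  have hA : 0 < D + V * sqNorm q := by positivity
  have : V / (D * (D + V * sqNorm q)) * ‖corr u q‖ ^ 2 ≤ sqNorm u / D := by
    calc _ ≤ V / (D * (D + V * sqNorm q)) * (sqNorm u * sqNorm q) := by gcongr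
      _ = sqNorm u / D * (V * sqNorm q / (D + V * sqNorm q)) := by field_simp
      _ ≤ sqNorm u / D * 1 := by
          gcongr
          rw [div_le_one hA]
          linarith
      _ = _ := mul_one _
  unfold rankOneExponent
  linarith

/-- Parallelogram law: averaging over `ξ ↦ -ξ`, which preserves the Gaussian law, removes the cross
terms between signal and noise. -/
lemma rankOneExponent_add_neg (D V : ℝ) (q ξ : ι → ℂ) (a b : ℂ) :
    rankOneExponent D V q (a • q + b • ξ) + rankOneExponent D V q (a • q + b • -ξ) =
      2 * (‖a‖ ^ 2 * (-(sqNorm q / D) + V / (D * (D + V * sqNorm q)) * sqNorm q ^ 2) +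
        ‖b‖ ^ 2 * (-(sqNorm ξ / D) + V / (D * (D + V * sqNorm q)) * ‖corr ξ q‖ ^ 2)) := by
  have h1 := sqNorm_add_add_sqNorm_sub (a • q) (b • ξ)
  rw [sqNorm_smul, sqNorm_smul, ← smul_neg] at h1
  have h2 : ‖corr (a • q + b • ξ) q‖ ^ 2 + ‖corr (a • q + b • -ξ) q‖ ^ 2 =
      2 * (‖a‖ ^ 2 * sqNorm q ^ 2 + ‖b‖ ^ 2 * ‖corr ξ q‖ ^ 2) := by
    rw [corr_add_left, corr_add_left, corr_smul_left, corr_smul_left, corr_smul_left,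
      corr_neg_left, corr_self]
    have := parallelogram_law_with_norm ℝ (a * (sqNorm q : ℂ)) (b * corr ξ q)
    rw [mul_neg, ← sub_eq_add_neg, this]
    simp only [norm_mul, Complex.norm_real, Real.norm_eq_abs, mul_pow, sq_abs]
  unfold rankOneExponent
  linear_combination (-1 / D) * h1 + V / (D * (D + V * sqNorm q)) * h2

/-- Given `q`, the vector `(f - c) q + √s ξ` has second-moment matrix exactly `D I + V q qᴴ`, so its
quadratic form in the inverse matrix has mean equal to the dimension. Only second moments of the
gain and the mean of `s` enter. -/
lemma integrable_rankOneExponent_and_integral (hf : Measurable f) (hs : Measurable s)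
    (hpos : ∀ᵐ ω ∂ρ, 0 < s ω) (hsi : Integrable s ρ) {D V : ℝ} (hD : 0 < D) {c : ℂ}
    (hfi : Integrable (fun ω => ‖f ω - c‖ ^ 2) ρ)
    (hDe : ∫ ω, s ω ∂ρ = D) (hVe : ∫ ω, ‖f ω - c‖ ^ 2 ∂ρ = V) :
    Integrable (fun p : Ω × (ι → ℂ) × (ι → ℂ) =>
        rankOneExponent D V p.2.1 (fadingOutput f s p - c • p.2.1))
      (ρ.prod ((stdComplexGaussian ι).prod (stdComplexGaussian ι))) ∧
    ∫ p, rankOneExponent D V p.2.1 (fadingOutput f s p - c • p.2.1)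
        ∂ρ.prod ((stdComplexGaussian ι).prod (stdComplexGaussian ι)) = -(Fintype.card ι : ℝ) := by
  have hV : 0 ≤ V := hVe ▸ integral_nonneg fun ω => by positivity
  set G := (stdComplexGaussian ι).prod (stdComplexGaussian ι) with hG
  set Q := ρ.prod G with hQ
  set ψ : Ω × (ι → ℂ) × (ι → ℂ) → ℝ := fun p =>
    rankOneExponent D V p.2.1 (fadingOutput f s p - c • p.2.1) with hψ
  have hψm : Measurable ψ := by
    have := measurable_rankOneExponent (ι := ι) D V
    exact this.comp (f := fun p : Ω × (ι → ℂ) × (ι → ℂ) =>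
      (p.2.1, fadingOutput f s p - c • p.2.1)) (by fun_prop)
  let σ : Ω × (ι → ℂ) × (ι → ℂ) → Ω × (ι → ℂ) × (ι → ℂ) := fun p => (p.1, (p.2.1, -p.2.2))
  have hσ : MeasurePreserving σ Q Q :=
    (MeasurePreserving.id ρ).prod ((MeasurePreserving.id _).prod
      measurePreserving_neg_stdComplexGaussian)
  have hψe : ∀ p, ψ p =
      rankOneExponent D V p.2.1 ((f p.1 - c) • p.2.1 + (√(s p.1) : ℂ) • p.2.2) := fun p => by
    simp only [hψ, fadingOutput, sub_smul]
    congr 1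
    abel
  set A : (ι → ℂ) × (ι → ℂ) → ℝ := fun z =>
    -(sqNorm z.1 / D) + V / (D * (D + V * sqNorm z.1)) * sqNorm z.1 ^ 2 with hA
  set B : (ι → ℂ) × (ι → ℂ) → ℝ := fun z =>
    -(sqNorm z.2 / D) + V / (D * (D + V * sqNorm z.1)) * ‖corr z.2 z.1‖ ^ 2 with hB
  have hs1 : Integrable (fun z : (ι → ℂ) × (ι → ℂ) => sqNorm z.1) G := integrable_sqNorm.comp_fst _
  have hs2 : Integrable (fun z : (ι → ℂ) × (ι → ℂ) => sqNorm z.2) G := integrable_sqNorm.comp_snd _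
  have hAB : ∀ᵐ p ∂Q, ψ p + ψ (σ p) = 2 * (‖f p.1 - c‖ ^ 2 * A p.2 + s p.1 * B p.2) := by
    filter_upwards [Measure.quasiMeasurePreserving_fst.ae hpos] with p hp
    rw [hψe, hψe, rankOneExponent_add_neg]
    simp [hA, hB, Real.sq_sqrt hp.le]
  have hA2 : Integrable (fun z : (ι → ℂ) × (ι → ℂ) =>
      V / (D * (D + V * sqNorm z.1)) * sqNorm z.1 ^ 2) G := by
    refine (hs1.div_const D).mono' (Measurable.aestronglyMeasurable (by fun_prop))
      (.of_forall fun z => ?_)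
    have hq := sqNorm_nonneg z.1
    have := rankOneExponent_nonpos hD hV z.1 z.1
    rw [Real.norm_of_nonneg (by positivity)]
    rw [rankOneExponent, corr_self, Complex.norm_real, Real.norm_of_nonneg hq] at this
    linarith
  have hB2 : Integrable (fun z : (ι → ℂ) × (ι → ℂ) =>
      V / (D * (D + V * sqNorm z.1)) * ‖corr z.2 z.1‖ ^ 2) G := by
    refine (hs2.div_const D).mono' (Measurable.aestronglyMeasurable (by fun_prop))
      (.of_forall fun z => ?_)
    have hq := sqNorm_nonneg z.1
    have := rankOneExponent_nonpos hD hV z.1 z.2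
    rw [Real.norm_of_nonneg (by positivity)]
    rw [rankOneExponent] at this
    linarith
  have hAi : Integrable A G := (hs1.div_const D).neg.add hA2
  have hBi : Integrable B G := (hs2.div_const D).neg.add hB2
  have hsum : Integrable (fun p : Ω × (ι → ℂ) × (ι → ℂ) =>
      2 * (‖f p.1 - c‖ ^ 2 * A p.2 + s p.1 * B p.2)) Q :=
    ((hfi.mul_prod hAi).add (hsi.mul_prod hBi)).const_mul 2
  have hψ0 : ∀ p, ψ p ≤ 0 := fun p => rankOneExponent_nonpos hD hV _ _
  -- Both `ψ` and its reflection are nonpositive, so `|ψ|` is dominated by the absolute value of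
  -- their sum, in which the cross terms are gone.
  have hψi : Integrable ψ Q := by
    refine hsum.mono hψm.aestronglyMeasurable ?_
    filter_upwards [hAB] with p hp
    rw [← hp, Real.norm_of_nonpos (hψ0 p), Real.norm_of_nonpos (add_nonpos (hψ0 _) (hψ0 _))]
    linarith [hψ0 (σ p)]
  refine ⟨hψi, ?_⟩
  have hcard1 : ∫ z, sqNorm z.1 ∂G = Fintype.card ι := by
    rw [hG, integral_fun_fst sqNorm, integral_sqNorm]; simp
  have hcard2 : ∫ z, sqNorm z.2 ∂G = Fintype.card ι := by
    rw [hG, integral_fun_snd sqNorm, integral_sqNorm]; simp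
  have hB3 : ∫ z, V / (D * (D + V * sqNorm z.1)) * ‖corr z.2 z.1‖ ^ 2 ∂G =
      ∫ z, V / (D * (D + V * sqNorm z.1)) * sqNorm z.1 ∂G := by
    rw [hG, integral_fun_fst (fun q => V / (D * (D + V * sqNorm q)) * sqNorm q),
      integral_prod _ hB2]
    simp [integral_const_mul, integral_norm_corr_sq]
  have hB4 : Integrable (fun z : (ι → ℂ) × (ι → ℂ) =>
      V / (D * (D + V * sqNorm z.1)) * sqNorm z.1) G := by
    refine ((hs1.const_mul (V / (D * D)))).mono' (Measurable.aestronglyMeasurable (by fun_prop))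
      (.of_forall fun z => ?_)
    have hq := sqNorm_nonneg z.1
    rw [Real.norm_of_nonneg (by positivity)]
    gcongr
    linarith [mul_nonneg hV hq]
  -- Pointwise the two integrands add up to `V ‖q‖² / D`: the factor `D + V ‖q‖²` cancels.
  have hfin : V * ∫ z, V / (D * (D + V * sqNorm z.1)) * sqNorm z.1 ^ 2 ∂G +
      D * ∫ z, V / (D * (D + V * sqNorm z.1)) * sqNorm z.1 ∂G = V * Fintype.card ι / D := by
    rw [← integral_const_mul, ← integral_const_mul,
      ← integral_add (hA2.const_mul V) (hB4.const_mul D), ← hcard1, mul_div_right_comm,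
      ← integral_const_mul]
    refine integral_congr_ae (.of_forall fun z => ?_)
    have : 0 < D + V * sqNorm z.1 := by
      have hq := sqNorm_nonneg z.1
      positivity
    simp only
    field_simp
    ring
  have hAint : ∫ z, A z ∂G = -(Fintype.card ι / D) +
      ∫ z, V / (D * (D + V * sqNorm z.1)) * sqNorm z.1 ^ 2 ∂G := by
    have hn : Integrable (fun z : (ι → ℂ) × (ι → ℂ) => -(sqNorm z.1 / D)) G :=
      (hs1.div_const D).neg
    rw [hA, integral_add hn hA2, integral_neg, integral_div, hcard1]
  have hBint : ∫ z, B z ∂G = -(Fintype.card ι / D) +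
      ∫ z, V / (D * (D + V * sqNorm z.1)) * sqNorm z.1 ∂G := by
    have hn : Integrable (fun z : (ι → ℂ) × (ι → ℂ) => -(sqNorm z.2 / D)) G :=
      (hs2.div_const D).neg
    rw [hB, integral_add hn hB2, integral_neg, integral_div, hcard2, hB3]
  have h2 : ∫ p, ψ p ∂Q + ∫ p, ψ (σ p) ∂Q = 2 * (V * ∫ z, A z ∂G + D * ∫ z, B z ∂G) := by
    rw [← integral_add (g := fun p => ψ (σ p)) hψi (hσ.integrable_comp_of_integrable hψi),
      integral_congr_ae hAB,
      integral_const_mul, integral_add (hfi.mul_prod hAi) (hsi.mul_prod hBi),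
      integral_prod_mul (fun ω => ‖f ω - c‖ ^ 2) A, integral_prod_mul s B, hVe, hDe]
  have h3 : ∫ p, ψ (σ p) ∂Q = ∫ p, ψ p ∂Q := by
    conv_rhs => rw [← hσ.map_eq]
    rw [integral_map hσ.measurable.aemeasurable hψm.aestronglyMeasurable]
  rw [h3, hAint, hBint] at h2
  linear_combination h2 / 2 + hfin - mul_div_cancel₀ (Fintype.card ι : ℝ) hD.ne'

end

/-- The tangent line of the concave logarithm. With `y` the mean of `x`, integrating it is Jensen's
inequality. -/
lemma log_one_add_le_log_add_div {x y : ℝ} (hx : 0 ≤ x) (hy : 0 ≤ y) :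
    Real.log (1 + x) ≤ Real.log (1 + y) + (x - y) / (1 + y) := by
  have h := Real.log_le_sub_one_of_pos (x := (1 + x) / (1 + y)) (by positivity)
  rw [Real.log_div (by positivity) (by positivity)] at h
  have : (1 + x) / (1 + y) - 1 = (x - y) / (1 + y) := by field_simp; ring
  linarith

/-! ### Lower bound on the mutual information of the fading channel -/

section

variable {ι : Type*} [Fintype ι] {Ω : Type*} [MeasurableSpace Ω] {ρ : Measure Ω}
  [IsProbabilityMeasure ρ] {f : Ω → ℂ} {s : Ω → ℝ}

lemma map_fadingOutput (hf : Measurable f) (hs : Measurable s) (hpos : ∀ᵐ ω ∂ρ, 0 < s ω) :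
    (ρ.prod ((stdComplexGaussian ι).prod (stdComplexGaussian ι))).map (fadingOutput f s) =
      volume.withDensity (mixturePDF ρ fun ω => ‖f ω‖ ^ 2 + s ω) := by
  have hT : Measurable fun ω => ‖f ω‖ ^ 2 + s ω := by fun_prop
  rw [← map_mixture_eq_withDensity hT (hpos.mono fun ω hω => by positivity),
    ← (measurePreserving_normalized_fadingOutput hf hs hpos).map_eq,
    Measure.map_map (by fun_prop) (measurePreserving_normalized_fadingOutput hf hs hpos).measurable]
  exact Measure.map_congr (fadingOutput_eq_smul hpos)

lemma integrable_log_density_and_integral_le (hf : Measurable f) (hs : Measurable s)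
    (hpos : ∀ᵐ ω ∂ρ, 0 < s ω) (hsi : Integrable s ρ) (hf2 : MemLp f 2 ρ)
    (hlog : Integrable (fun ω => Real.log (‖f ω‖ ^ 2 + s ω)) ρ) :
    Integrable (fun p => Real.log
        (mixturePDF ρ (fun ω => ‖f ω‖ ^ 2 + s ω) (fadingOutput f s p)).toReal)
      (ρ.prod ((stdComplexGaussian ι).prod (stdComplexGaussian ι))) ∧
    ∫ p, Real.log (mixturePDF ρ (fun ω => ‖f ω‖ ^ 2 + s ω) (fadingOutput f s p)).toReal
        ∂ρ.prod ((stdComplexGaussian ι).prod (stdComplexGaussian ι)) ≤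
      -(Fintype.card ι * (Real.log Real.pi + ∫ ω, Real.log (‖f ω‖ ^ 2 + s ω) ∂ρ)) -
        Fintype.card ι := by
  have hT : Measurable fun ω => ‖f ω‖ ^ 2 + s ω := by fun_prop
  have hmp := measurePreserving_normalized_fadingOutput (ι := ι) hf hs hpos
  have hpm := measurable_mixturePDF (ι := ι) (ρ := ρ) hT
  obtain ⟨h1, h2⟩ := integrable_log_mixturePDF_and_integral_le (ι := ι) hT
    (hpos.mono fun ω hω => by positivity) ((hf2.integrable_norm_pow (by simp)).add hsi) hlog
  have he : (fun p => Real.log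
        (mixturePDF ρ (fun ω => ‖f ω‖ ^ 2 + s ω) (fadingOutput f s p)).toReal) =ᵐ[
          ρ.prod ((stdComplexGaussian ι).prod (stdComplexGaussian ι))]
      (fun p : Ω × (ι → ℂ) => Real.log (mixturePDF ρ (fun ω => ‖f ω‖ ^ 2 + s ω)
        ((√(‖f p.1‖ ^ 2 + s p.1) : ℂ) • p.2)).toReal) ∘
        fun p => (p.1, (√(‖f p.1‖ ^ 2 + s p.1) : ℂ)⁻¹ • fadingOutput f s p) := by
    filter_upwards [fadingOutput_eq_smul (ι := ι) (f := f) hpos] with p hp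
    simp only [Function.comp_apply, ← hp]
  refine ⟨(hmp.integrable_comp_of_integrable h1).congr he.symm, ?_⟩
  rw [integral_congr_ae he]
  simp only [Function.comp_def]
  rw [← integral_map (φ := fun p => (p.1, (√(‖f p.1‖ ^ 2 + s p.1) : ℂ)⁻¹ • fadingOutput f s p))
    (f := fun p : Ω × (ι → ℂ) => Real.log (mixturePDF ρ (fun ω => ‖f ω‖ ^ 2 + s ω)
        ((√(‖f p.1‖ ^ 2 + s p.1) : ℂ) • p.2)).toReal) hmp.measurable.aemeasurable
    (Measurable.aestronglyMeasurable (by fun_prop)), hmp.map_eq]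
  exact h2

/-- A lower bound on the mutual information between the input and the output of a fading channel
whose gain `f` and noise variance `s` are constant over the block and unknown to the receiver. -/
theorem ofReal_le_klDiv_fadingOutput (hf : Measurable f) (hs : Measurable s)
    (hpos : ∀ᵐ ω ∂ρ, 0 < s ω) (hsi : Integrable s ρ) (hf2 : MemLp f 2 ρ)
    (hlog : Integrable (fun ω => Real.log (‖f ω‖ ^ 2 + s ω)) ρ) {D V : ℝ} (hD : 0 < D) (c : ℂ)
    (hDe : ∫ ω, s ω ∂ρ = D) (hVe : ∫ ω, ‖f ω - c‖ ^ 2 ∂ρ = V) :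
    ENNReal.ofReal (Fintype.card ι * (∫ ω, Real.log (‖f ω‖ ^ 2 + s ω) ∂ρ - Real.log D) -
        Real.log (1 + Fintype.card ι * V / D)) ≤
      InformationTheory.klDiv
        ((ρ.prod ((stdComplexGaussian ι).prod (stdComplexGaussian ι))).map
          fun p => (p.2.1, fadingOutput f s p))
        ((stdComplexGaussian ι).prod
          ((ρ.prod ((stdComplexGaussian ι).prod (stdComplexGaussian ι))).map
            (fadingOutput f s))) := by
  have hV : 0 ≤ V := hVe ▸ integral_nonneg fun ω => by positivity
  have hT : Measurable fun ω => ‖f ω‖ ^ 2 + s ω := by fun_prop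
  have hTpos : ∀ᵐ ω ∂ρ, 0 < ‖f ω‖ ^ 2 + s ω := hpos.mono fun ω hω => by positivity
  have hmap := map_fadingOutput (ι := ι) hf hs hpos
  obtain ⟨hL, hLle⟩ := integrable_log_density_and_integral_le (ι := ι) hf hs hpos hsi hf2 hlog
  obtain ⟨hψ, hψe⟩ := integrable_rankOneExponent_and_integral (ι := ι) hf hs hpos hsi hD (c := c)
    ((hf2.sub (memLp_const c)).integrable_norm_pow (by simp)) hDe hVe
  set Q := ρ.prod ((stdComplexGaussian ι).prod (stdComplexGaussian ι)) with hQ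
  set g := mixturePDF (ι := ι) ρ (fun ω => ‖f ω‖ ^ 2 + s ω) with hg
  have hgm : Measurable g := measurable_mixturePDF hT
  have hg1 : ∫⁻ x, g x = 1 := lintegral_mixturePDF hT hTpos
  -- A mismatched log-likelihood ratio: the numerator is the Gaussian with the first two conditional
  -- moments of the output when `c` is the mean gain, the denominator the true output density.
  set φ : (ι → ℂ) × (ι → ℂ) → ℝ := fun z =>
    Real.log (rankOnePDF D V z.1 (z.2 - c • z.1)) - Real.log (g z.2).toReal with hφ
  have hrm : Measurable fun z : (ι → ℂ) × (ι → ℂ) => rankOnePDF D V z.1 (z.2 - c • z.1) :=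
    (measurable_rankOnePDF D V).comp (f := fun z : (ι → ℂ) × (ι → ℂ) => (z.1, z.2 - c • z.1))
      (by fun_prop)
  have hφm : Measurable φ := by fun_prop
  have hjm : Measurable fun p : Ω × (ι → ℂ) × (ι → ℂ) => (p.2.1, fadingOutput f s p) := by
    fun_prop
  have := Measure.isProbabilityMeasure_map (μ := Q) hjm.aemeasurable
  have := Measure.isProbabilityMeasure_map (μ := Q) (f := fadingOutput f s)
    (measurable_fadingOutput hf hs).aemeasurable
  -- the normalization of the test function
  have hle : ∫⁻ z, ENNReal.ofReal (Real.exp (φ z))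
      ∂(stdComplexGaussian ι).prod (Q.map (fadingOutput f s)) ≤ 1 := by
    rw [hmap] at this ⊢
    rw [lintegral_prod _ (by fun_prop)]
    calc _ ≤ ∫⁻ _ : ι → ℂ, 1 ∂stdComplexGaussian ι := lintegral_mono fun q => ?_
      _ = 1 := by simp
    rw [lintegral_withDensity_eq_lintegral_mul _ hgm (by fun_prop),
      ← lintegral_rankOnePDF hD hV q,
      ← lintegral_sub_right_eq_self (fun u => ENNReal.ofReal (rankOnePDF D V q u)) (c • q)]
    refine lintegral_mono_ae ?_
    filter_upwards [ae_lt_top hgm (by simp [hg1])] with x hx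
    -- Mass of the Gaussian numerator where `g` vanishes is lost, so the normalization is an
    -- inequality.
    rcases eq_or_ne (g x) 0 with h0 | h0
    · simp [h0]
    simp only [Pi.mul_apply, hφ]
    rw [Real.exp_sub, Real.exp_log (rankOnePDF_pos hD hV _ _),
      Real.exp_log (ENNReal.toReal_pos h0 hx.ne), ENNReal.ofReal_div_of_pos
      (ENNReal.toReal_pos h0 hx.ne), ENNReal.ofReal_toReal hx.ne, ENNReal.mul_div_cancel h0 hx.ne]
  -- the expectation of the test function
  set m : ℝ := Fintype.card ι * V / D with hm
  have hsq : Integrable (fun p : Ω × (ι → ℂ) × (ι → ℂ) => sqNorm p.2.1) Q :=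
    (integrable_sqNorm.comp_fst _).comp_snd _
  have hsqe : ∫ p, sqNorm p.2.1 ∂Q = Fintype.card ι := by
    rw [hQ, integral_fun_snd (fun z : (ι → ℂ) × (ι → ℂ) => sqNorm z.1), integral_fun_fst sqNorm,
      integral_sqNorm]
    simp
  -- The log-normalizer of `rankOnePDF` with `log (1 + V ‖q‖² / D)` replaced by its tangent at the
  -- mean `m`; the linear correction has mean zero.
  set lin : Ω × (ι → ℂ) × (ι → ℂ) → ℝ := fun p =>
    -(Fintype.card ι * Real.log (Real.pi * D)) -
      (Real.log (1 + m) + (V * sqNorm p.2.1 / D - m) / (1 + m)) with hlin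
  have hlini : Integrable lin Q :=
    (integrable_const _).sub ((integrable_const _).add
      ((((hsq.const_mul V).div_const D).sub (integrable_const _)).div_const _))
  have hline : ∫ p, lin p ∂Q =
      -(Fintype.card ι * Real.log (Real.pi * D)) - Real.log (1 + m) := by
    have h0 : Integrable (fun p : Ω × (ι → ℂ) × (ι → ℂ) => V * sqNorm p.2.1 / D) Q :=
      (hsq.const_mul V).div_const D
    have h1 : Integrable (fun p : Ω × (ι → ℂ) × (ι → ℂ) =>
        (V * sqNorm p.2.1 / D - m) / (1 + m)) Q := (h0.sub (integrable_const _)).div_const _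
    have h2 : Integrable (fun p : Ω × (ι → ℂ) × (ι → ℂ) =>
        Real.log (1 + m) + (V * sqNorm p.2.1 / D - m) / (1 + m)) Q := (integrable_const _).add h1
    rw [hlin, integral_sub (integrable_const _) h2, integral_add (integrable_const _) h1,
      integral_div, integral_sub h0 (integrable_const _), integral_div, integral_const_mul, hsqe]
    simp only [integral_const, probReal_univ, one_smul, hm]
    ring
  have hlogg : ∀ p : Ω × (ι → ℂ) × (ι → ℂ),
      Real.log (rankOnePDF D V p.2.1 (fadingOutput f s p - c • p.2.1)) =
        -(Fintype.card ι * Real.log (Real.pi * D)) - Real.log (1 + V * sqNorm p.2.1 / D) +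
          rankOneExponent D V p.2.1 (fadingOutput f s p - c • p.2.1) := by
    intro p
    have hq := sqNorm_nonneg p.2.1
    rw [rankOnePDF, ← rankOneExponent, Real.log_mul (by positivity) (Real.exp_ne_zero _),
      Real.log_mul (by positivity) (by positivity), Real.log_exp, Real.log_pow, Real.log_inv,
      Real.log_inv]
    ring
  have hlog1 : Integrable (fun p : Ω × (ι → ℂ) × (ι → ℂ) =>
      Real.log (1 + V * sqNorm p.2.1 / D)) Q := by
    refine ((hsq.const_mul V).div_const D).mono' (Measurable.aestronglyMeasurable (by fun_prop))
      (.of_forall fun p => ?_)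
    have hq := sqNorm_nonneg p.2.1
    have h0 : 0 ≤ V * sqNorm p.2.1 / D := by positivity
    rw [Real.norm_of_nonneg (Real.log_nonneg (by linarith))]
    have := Real.log_le_sub_one_of_pos (x := 1 + V * sqNorm p.2.1 / D) (by positivity)
    linarith
  have hφi : Integrable (fun p => φ (p.2.1, fadingOutput f s p)) Q := by
    simp only [hφ, hlogg]
    exact (((integrable_const _).sub hlog1).add hψ).sub hL
  have hm0 : 0 ≤ m := by positivity
  have hφle : ∫ p, (lin p + rankOneExponent D V p.2.1 (fadingOutput f s p - c • p.2.1) -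
      Real.log (g (fadingOutput f s p)).toReal) ∂Q ≤ ∫ p, φ (p.2.1, fadingOutput f s p) ∂Q := by
    refine integral_mono ((hlini.add hψ).sub hL) hφi fun p => ?_
    have hq := sqNorm_nonneg p.2.1
    have := log_one_add_le_log_add_div (x := V * sqNorm p.2.1 / D) (y := m) (by positivity) hm0
    simp only [hφ, hlogg, hlin]
    linarith
  have hls : Integrable (fun p => lin p +
      rankOneExponent D V p.2.1 (fadingOutput f s p - c • p.2.1)) Q := hlini.add hψ
  rw [integral_sub hls hL, integral_add hlini hψ, hline, hψe] at hφle
  refine le_trans (ENNReal.ofReal_le_ofReal ?_) (ofReal_integral_le_klDiv hφm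
    ((integrable_map_measure hφm.aestronglyMeasurable hjm.aemeasurable).2 hφi) hle)
  rw [integral_map hjm.aemeasurable hφm.aestronglyMeasurable]
  refine le_trans ?_ hφle
  rw [Real.log_mul Real.pi_ne_zero hD.ne']
  linarith

end

/-! ### Integrability of the logarithm of a Gaussian -/

/-- Near zero the Gaussian density is bounded and `log` is Lebesgue integrable; elsewhere `|log x| ≤
|x|`. -/
lemma integrable_log_gaussianReal {v : ℝ≥0} (hv : v ≠ 0) :
    Integrable Real.log (gaussianReal 0 v) := by
  set C : ℝ≥0∞ := ENNReal.ofReal (√(2 * Real.pi * v))⁻¹ with hC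
  have hle : gaussianReal 0 v ≤ C • (volume : Measure ℝ) := by
    rw [gaussianReal_of_var_ne_zero _ hv, ← withDensity_const]
    refine withDensity_mono (.of_forall fun x => ENNReal.ofReal_le_ofReal ?_)
    rw [gaussianPDFReal]
    refine mul_le_of_le_one_right (by positivity) (Real.exp_le_one_iff.2 ?_)
    exact div_nonpos_of_nonpos_of_nonneg (by nlinarith [sq_nonneg (x - 0)]) (by positivity)
  have hloc : Integrable ((Set.Ioc (-1 : ℝ) 1).indicator Real.log) := by
    rw [integrable_indicator_iff measurableSet_Ioc,
      ← intervalIntegrable_iff_integrableOn_Ioc_of_le (by norm_num)]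
    exact intervalIntegral.intervalIntegrable_log'
  have hloc' : Integrable ((Set.Ioc (-1 : ℝ) 1).indicator Real.log) (gaussianReal 0 v) :=
    hloc.of_measure_le_smul ENNReal.ofReal_ne_top hle
  have hid : Integrable (fun x : ℝ => x) (gaussianReal 0 v) :=
    (memLp_id_gaussianReal' 1 (by simp)).integrable le_rfl
  refine (hloc'.norm.add hid.norm).mono' Real.measurable_log.aestronglyMeasurable
    (.of_forall fun x => ?_)
  simp only [Pi.add_apply]
  by_cases hx : x ∈ Set.Ioc (-1 : ℝ) 1
  · simp [Set.indicator_of_mem hx]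
  · simp only [Set.indicator_of_notMem hx, norm_zero, zero_add, Real.norm_eq_abs]
    have h1 : 1 ≤ |x| := by
      rw [Set.mem_Ioc, not_and_or, not_lt, not_le] at hx
      rcases hx with h | h
      · rw [le_abs]; right; linarith
      · rw [le_abs]; left; linarith
    rw [← Real.log_abs, abs_of_nonneg (Real.log_nonneg h1)]
    linarith [Real.log_le_sub_one_of_pos (lt_of_lt_of_le one_pos h1)]

lemma ae_ne_zero_complexGaussian {v : ℝ≥0} (hv : v ≠ 0) : ∀ᵐ z ∂complexGaussian v, z ≠ 0 := by
  rw [complexGaussian_eq_withDensity hv]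
  have h : ∀ᵐ z : ℂ, z ≠ 0 := by simp [ae_iff]
  exact (withDensity_absolutelyContinuous _ _).ae_le h

lemma measurePreserving_re_complexGaussian (v : ℝ≥0) :
    MeasurePreserving Complex.re (complexGaussian v) (gaussianReal 0 (v / 2)) := by
  refine ⟨Complex.measurable_re, ?_⟩
  rw [complexGaussian, Measure.map_map Complex.measurable_re (by fun_prop)]
  exact measurePreserving_fst.map_eq

lemma integrable_log_norm_complexGaussian {v : ℝ≥0} (hv : v ≠ 0) :
    Integrable (fun z => Real.log ‖z‖) (complexGaussian v) := by
  have hv2 : v / 2 ≠ 0 := by simpa using hv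
  have hre := measurePreserving_re_complexGaussian v
  have h0 : ∀ᵐ z ∂complexGaussian v, z.re ≠ 0 := by
    have h : ∀ᵐ x : ℝ, x ≠ 0 := by simp [ae_iff]
    exact hre.quasiMeasurePreserving.ae (p := fun x => x ≠ 0)
      ((gaussianReal_absolutelyContinuous 0 hv2).ae_le h)
  -- The singularity at zero is controlled by the real part alone, as `|Re z| ≤ ‖z‖`.
  refine integrable_of_le_of_le (g₁ := fun z => Real.log z.re) (g₂ := fun z => ‖z‖)
    (Measurable.aestronglyMeasurable (by fun_prop)) ?_ ?_
    (hre.integrable_comp_of_integrable (integrable_log_gaussianReal hv2))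
    ((memLp_id_complexGaussian v (p := 1) (by simp)).integrable le_rfl).norm
  · filter_upwards [h0] with z hz
    rw [← Real.log_abs]
    exact Real.log_le_log (abs_pos.2 hz) (Complex.abs_re_le_norm z)
  · exact .of_forall fun z => Real.log_le_self (norm_nonneg z)

/-! ### Correlations of linear combinations of independent Gaussians -/

section correlation

variable {Ω κ : Type*} [MeasurableSpace Ω] {P : Measure Ω}
  {X : κ → Ω → ℂ} {v : κ → ℝ≥0}

lemma memLp_of_hasLaw_complexGaussian {Y : Ω → ℂ} {u : ℝ≥0} (hY : HasLaw Y (complexGaussian u) P)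
    {p : ℝ≥0∞} (hp : p ≠ ∞) : MemLp Y p P := by
  have := memLp_id_complexGaussian u hp
  rw [← hY.map_eq, memLp_map_measure_iff (by fun_prop) hY.aemeasurable] at this
  exact this

lemma integral_mul_conj_complexGaussian [DecidableEq κ]
    (hX : ∀ i, HasLaw (X i) (complexGaussian (v i)) P)
    (h : iIndepFun X P) (i j : κ) :
    ∫ ω, X i ω * conj (X j ω) ∂P = if i = j then (v i : ℂ) else 0 := by
  split_ifs with hij
  · subst hij
    have := (hX i).integral_comp (f := fun z => z * conj z) (by fun_prop)
    simp only [Function.comp_def] at this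
    rw [this]
    simp only [Complex.mul_conj, Complex.normSq_eq_norm_sq]
    rw [integral_complex_ofReal, integral_norm_sq_complexGaussian]
  · have hind : IndepFun (X i) (fun ω => conj (X j ω)) P :=
      (h.indepFun hij).comp measurable_id (Complex.continuous_conj.measurable)
    have := hind.integral_mul_eq_mul_integral (hX i).aemeasurable.aestronglyMeasurable
      (Complex.continuous_conj.measurable.comp_aemeasurable
        (hX j).aemeasurable).aestronglyMeasurable
    simp only [Pi.mul_apply] at this
    rw [show ∫ ω, X i ω * conj (X j ω) ∂P = _ from this, (hX i).integral_eq,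
      integral_id_complexGaussian, zero_mul]

lemma integral_sum_mul_conj_sum [Fintype κ]
    (hX : ∀ i, HasLaw (X i) (complexGaussian (v i)) P)
    (h : iIndepFun X P) (c d : κ → ℂ) :
    ∫ ω, (∑ i, c i * X i ω) * conj (∑ i, d i * X i ω) ∂P = ∑ i, c i * conj (d i) * v i := by
  classical
  have hint : ∀ i j, Integrable (fun ω => c i * conj (d j) * (X i ω * conj (X j ω))) P := by
    intro i j
    refine Integrable.const_mul ?_ _
    exact (memLp_of_hasLaw_complexGaussian (hX i) (p := 2) (by simp)).integrable_mul
      (memLp_of_hasLaw_complexGaussian (hX j) (p := 2) (by simp)).star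
  have he : ∀ ω, (∑ i, c i * X i ω) * conj (∑ i, d i * X i ω) =
      ∑ i, ∑ j, c i * conj (d j) * (X i ω * conj (X j ω)) := by
    intro ω
    rw [map_sum, Finset.sum_mul_sum]
    refine Finset.sum_congr rfl fun i _ => Finset.sum_congr rfl fun j _ => ?_
    rw [map_mul]
    ring
  simp_rw [he]
  rw [integral_finsetSum _ fun i _ => integrable_finsetSum _ fun j _ => hint i j]
  refine Finset.sum_congr rfl fun i _ => ?_
  rw [integral_finsetSum _ fun j _ => hint i j]
  simp [integral_const_mul, integral_mul_conj_complexGaussian hX h]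

end correlation

/-! ### Training phase and the LMMSE estimate -/

section

variable {Ω : Type*} {M N K τp τu : ℕ}

/-- The random variables that determine the channels and their estimates. -/
def Sources.training (S : Sources Ω M N K τp τu) :
    (Fin M × Fin K × Fin N) ⊕ (Fin M × Fin N × Fin τp) → Ω → ℂ :=
  Sum.elim (fun x => S.h x.1 x.2.1 x.2.2) (fun x => S.W x.1 x.2.1 x.2.2)

/-- The random variables of the data phase: symbols and noise. -/
def Sources.data (S : Sources Ω M N K τp τu) :
    (Fin K × Fin τu) ⊕ (Fin M × Fin τu × Fin N) → Ω → ℂ :=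
  Sum.elim (fun x => S.q x.1 x.2) (fun x => S.w x.1 x.2.1 x.2.2)

/-- The variances of the training variables. -/
def Network.trainingVar (net : Network M K τp) :
    (Fin M × Fin K × Fin N) ⊕ (Fin M × Fin N × Fin τp) → ℝ≥0 :=
  Sum.elim (fun _ => 1) (fun _ => net.σp ^ 2)

/-- The variances of the data variables. -/
def Network.dataVar (net : Network M K τp) :
    (Fin K × Fin τu) ⊕ (Fin M × Fin τu × Fin N) → ℝ≥0 :=
  Sum.elim (fun _ => 1) (fun _ => net.σw ^ 2)

variable {net : Network M K τp} {S : Sources Ω M N K τp τu}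

/-- Distinct users have orthogonal pilots, so projecting on one pilot removes every other user's
channel. -/
lemma sum_txPilot_mul_conj (net : Network M K τp) (k k' : Fin K) :
    ∑ t, txPilot net k' t * conj (txPilot net k t) =
      if k' = k then ((τp * net.ρp : ℝ) : ℂ) else 0 := by
  have h := net.ψ_orthonormal (net.pilot k') (net.pilot k)
  have h0 : (0 : ℝ) ≤ τp * net.ρp := mul_nonneg (Nat.cast_nonneg _) net.ρp_pos.le
  have h1 : (√(τp * net.ρp) : ℂ) * √(τp * net.ρp) = ((τp * net.ρp : ℝ) : ℂ) := by
    exact_mod_cast Real.mul_self_sqrt h0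
  have h2 : ∀ t, txPilot net k' t * conj (txPilot net k t) = ((τp * net.ρp : ℝ) : ℂ) *
      (net.ψ (net.pilot k') t * conj (net.ψ (net.pilot k) t)) := by
    intro t
    simp only [txPilot, map_mul, Complex.conj_ofReal]
    rw [← h1]
    ring
  simp_rw [h2]
  rw [← Finset.mul_sum, h]
  simp [net.pilot_injective.eq_iff]

/-- The coefficients of the projected pilot signal in terms of the training variables. -/
def pilotCoeff (net : Network M K τp) (m : Fin M) (k : Fin K) (a : Fin N) :
    (Fin M × Fin K × Fin N) ⊕ (Fin M × Fin N × Fin τp) → ℂ :=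
  Sum.elim
    (fun x => if x = (m, k, a) then ((τp * net.ρp : ℝ) : ℂ) * √(net.β m k) else 0)
    (fun x => if x.1 = m ∧ x.2.1 = a then conj (txPilot net k x.2.2) else 0)

lemma projPilot_eq_sum (m : Fin M) (k : Fin K) (a : Fin N) (ω : Ω) :
    projPilot net S m k a ω = ∑ i, pilotCoeff net m k a i * S.training i ω := by
  have h1 : projPilot net S m k a ω = ((τp * net.ρp : ℝ) : ℂ) * channel net S m k a ω +
      ∑ t, conj (txPilot net k t) * S.W m a t ω := by
    simp only [projPilot, rxPilot, add_mul, Finset.sum_add_distrib, Finset.sum_mul]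
    rw [Finset.sum_comm]
    congr 1
    · simp_rw [mul_assoc, ← Finset.mul_sum, sum_txPilot_mul_conj]
      simp [mul_comm]
    · exact Finset.sum_congr rfl fun t _ => mul_comm _ _
  rw [h1, Fintype.sum_sum_type]
  congr 1
  · simp [pilotCoeff, Sources.training, channel, mul_assoc]
  · simp [pilotCoeff, Sources.training, Fintype.sum_prod_type, ite_and]

lemma channel_eq_sum (m : Fin M) (k : Fin K) (a : Fin N) (ω : Ω) :
    channel net S m k a ω = ∑ i, (Sum.elim
      (fun x => if x = (m, k, a) then (√(net.β m k) : ℂ) else 0)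
      (fun _ => 0) : (Fin M × Fin K × Fin N) ⊕ (Fin M × Fin N × Fin τp) → ℂ) i *
        S.training i ω := by
  rw [Fintype.sum_sum_type]
  simp [Sources.training, channel]

/-- The variance of the projected pilot signal. -/
def pilotVar (net : Network M K τp) (m : Fin M) (k : Fin K) (a : Fin N) : ℝ≥0 :=
  ∑ i, ‖pilotCoeff net m k a i‖₊ ^ 2 * net.trainingVar i

lemma pos_trainingLength (net : Network M K τp) (k : Fin K) : 0 < τp :=
  (Nat.zero_le _).trans_lt (net.pilot k).isLt

lemma pilotVar_pos (m : Fin M) (k : Fin K) (a : Fin N) : 0 < pilotVar net m k a := by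
  have hτ := pos_trainingLength net k
  refine Finset.sum_pos' (fun _ _ => zero_le) ⟨.inl (m, k, a), Finset.mem_univ _, ?_⟩
  have h1 := net.ρp_pos
  have h2 := Real.sqrt_pos.2 (net.β_pos m k)
  simp [pilotCoeff, Network.trainingVar, hτ.ne', h1.ne', h2.ne', pos_iff_ne_zero]

variable [MeasurableSpace Ω] {P : Measure Ω}

lemma IsModel.hasLaw_training (hS : IsModel net S P)
    (i : (Fin M × Fin K × Fin N) ⊕ (Fin M × Fin N × Fin τp)) :
    HasLaw (S.training i) (complexGaussian (net.trainingVar i)) P := by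
  rcases i with i | i
  · exact hS.law_h _ _ _
  · exact hS.law_W _ _ _

lemma IsModel.hasLaw_data (hS : IsModel net S P)
    (i : (Fin K × Fin τu) ⊕ (Fin M × Fin τu × Fin N)) :
    HasLaw (S.data i) (complexGaussian (net.dataVar i)) P := by
  rcases i with i | i
  · exact hS.law_q _ _
  · exact hS.law_w _ _ _

lemma IsModel.iIndepFun_training_data (hS : IsModel net S P) :
    iIndepFun (Sum.elim S.training S.data) P := by
  have h := hS.indep.precomp (Equiv.sumAssoc (Fin M × Fin K × Fin N) (Fin M × Fin N × Fin τp)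
    ((Fin K × Fin τu) ⊕ (Fin M × Fin τu × Fin N))).injective
  convert h using 1
  ext i
  rcases i with (i | i) | (i | i) <;> rfl

lemma IsModel.iIndepFun_training (hS : IsModel net S P) : iIndepFun S.training P :=
  hS.iIndepFun_training_data.precomp (g := Sum.inl) Sum.inl_injective

/-- The training and the data variables are jointly independent complex Gaussians. -/
lemma IsModel.hasLaw_training_data (hS : IsModel net S P) :
    HasLaw (fun ω => ((fun i => S.training i ω), (fun i => S.data i ω)))
      ((Measure.pi fun i => complexGaussian (net.trainingVar i)).prod
        (Measure.pi fun i => complexGaussian (net.dataVar i))) P := by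
  have h := hS.iIndepFun_training_data.hasLaw_pi (μ := fun i => complexGaussian
    (Sum.elim net.trainingVar net.dataVar i)) fun i => by
      rcases i with i | i
      · exact hS.hasLaw_training i
      · exact hS.hasLaw_data i
  exact (measurePreserving_sumPiEquivProdPi fun i => complexGaussian
    (Sum.elim net.trainingVar net.dataVar i)).hasLaw.comp h

lemma IsModel.hasLaw_projPilot (hS : IsModel net S P) (m : Fin M) (k : Fin K) (a : Fin N) :
    HasLaw (projPilot net S m k a) (complexGaussian (pilotVar net m k a)) P := by
  have h := hasLaw_sum_mul_complexGaussian hS.hasLaw_training hS.iIndepFun_training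
    (pilotCoeff net m k a)
  simp only [← projPilot_eq_sum] at h
  exact h

/-- The estimate is a nonzero multiple of the projected pilot signal. -/
lemma IsModel.exists_estChannel_eq (hS : IsModel net S P) :
    ∃ κ : Fin M → Fin K → Fin N → ℂ, (∀ m k a, κ m k a ≠ 0) ∧
      ∀ m k a ω, estChannel net S P m k a ω = κ m k a * projPilot net S m k a ω := by
  have key : ∀ m k, ∃ κ : Fin N → ℂ, (∀ a, κ a ≠ 0) ∧
      ∀ a ω, estChannel net S P m k a ω = κ a * projPilot net S m k a ω := by
    intro m k
    have hτ : (0 : ℝ) < τp := by exact_mod_cast pos_trainingLength net k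
    set x : Fin N → ℂ := fun _ => ((τp * net.ρp : ℝ) : ℂ) * (√(net.β m k) * √(net.β m k) : ℝ)
      with hx
    set y : Fin N → ℂ := fun a => (pilotVar net m k a : ℂ) with hy
    have hx0 : ∀ a, x a ≠ 0 := fun a => by
      have h1 := net.ρp_pos
      have h2 := Real.sqrt_pos.2 (net.β_pos m k)
      simp only [hx]
      norm_cast
      positivity
    have hy0 : ∀ a, y a ≠ 0 := fun a => by
      simpa [hy] using (pilotVar_pos (net := net) m k a).ne'
    -- Different antennas share no primitive variable, so both correlation matrices are diagonal,
    -- with nonzero entries, and the LMMSE filter acts antenna by antenna.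
    have hcross : (Matrix.of fun b d => ∫ ω', channel net S m k b ω' *
        conj (projPilot net S m k d ω') ∂P) = Matrix.diagonal x := by
      ext b d
      simp only [Matrix.of_apply, channel_eq_sum, projPilot_eq_sum]
      rw [integral_sum_mul_conj_sum hS.hasLaw_training hS.iIndepFun_training,
        Fintype.sum_sum_type]
      rcases eq_or_ne b d with rfl | hbd
      · simp [pilotCoeff, Network.trainingVar, hx]
        ring
      · simp [pilotCoeff, Network.trainingVar, hbd, Matrix.diagonal_apply_ne]
    have hauto : (Matrix.of fun b d => ∫ ω', projPilot net S m k b ω' *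
        conj (projPilot net S m k d ω') ∂P) = Matrix.diagonal y := by
      ext b d
      simp only [Matrix.of_apply, projPilot_eq_sum]
      rw [integral_sum_mul_conj_sum hS.hasLaw_training hS.iIndepFun_training]
      rcases eq_or_ne b d with rfl | hbd
      · simp [hy, pilotVar, Complex.mul_conj, Complex.normSq_eq_norm_sq]
      · rw [Matrix.diagonal_apply_ne _ hbd]
        refine Finset.sum_eq_zero fun i _ => ?_
        rcases i with i | i
        · by_cases h : i = (m, k, b)
          · simp [pilotCoeff, h, hbd]
          · simp [pilotCoeff, h]
        · by_cases h : i.2.1 = b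
          · simp [pilotCoeff, h, hbd]
          · simp [pilotCoeff, h]
    have hinv : (Matrix.diagonal y)⁻¹ = Matrix.diagonal fun a => (y a)⁻¹ := by
      refine Matrix.inv_eq_right_inv ?_
      rw [Matrix.diagonal_mul_diagonal]
      simp [hy0]
    refine ⟨fun a => x a * (y a)⁻¹, fun a => mul_ne_zero (hx0 a) (inv_ne_zero (hy0 a)),
      fun a ω => ?_⟩
    simp only [estChannel]
    rw [hcross, hauto, hinv, Matrix.diagonal_mul_diagonal, Matrix.mulVec_diagonal]
  choose κ h1 h2 using key
  exact ⟨κ, h1, h2⟩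

end

/-! ### Data phase: symbols and normalized interference plus noise -/

section

variable {M N K τp τu : ℕ}

/-- Assigns the symbols of user `k` to the left blocks and every other data variable to the right
block of its sample. -/
def blockIndex (k : Fin K) :
    (Fin K × Fin τu) ⊕ (Fin M × Fin τu × Fin N) → Fin τu ⊕ Fin τu :=
  Sum.elim (fun x => if x.1 = k then .inl x.2 else .inr x.2) (fun x => .inr x.2.1)

lemma sum_blockIndex_inl {R : Type*} [AddCommMonoid R] (k : Fin K) (n : Fin τu)
    (F : (Fin K × Fin τu) ⊕ (Fin M × Fin τu × Fin N) → R) :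
    ∑ i with blockIndex k i = .inl n, F i = F (.inl (k, n)) := by
  refine Finset.sum_eq_single_of_mem _
    (Finset.mem_filter.2 ⟨Finset.mem_univ _, by simp [blockIndex]⟩)
    fun i hi hne => ?_
  exfalso
  have hi' := (Finset.mem_filter.1 hi).2
  rcases i with ⟨k', n'⟩ | i
  · by_cases h : k' = k
    · simp [blockIndex, h] at hi'
      exact hne (by rw [h, hi'])
    · simp [blockIndex, h] at hi'
  · simp [blockIndex] at hi'

lemma sum_blockIndex_inr {R : Type*} [AddCommMonoid R] (k : Fin K) (n : Fin τu)
    (F : (Fin K × Fin τu) ⊕ (Fin M × Fin τu × Fin N) → R) :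
    ∑ i with blockIndex k i = .inr n, F i =
      ∑ k' ∈ Finset.univ.erase k, F (.inl (k', n)) + ∑ m, ∑ a, F (.inr (m, n, a)) := by
  rw [Finset.sum_filter, Fintype.sum_sum_type, Fintype.sum_prod_type]
  congr 1
  · rw [← Finset.add_sum_erase _ _ (Finset.mem_univ k)]
    rw [Finset.sum_eq_zero fun n' _ => if_neg (by simp [blockIndex]), zero_add]
    refine Finset.sum_congr rfl fun k' hk' => ?_
    have hne := Finset.ne_of_mem_erase hk'
    rw [Finset.sum_eq_single_of_mem n (Finset.mem_univ _) fun n' _ hn' =>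
      if_neg (by simpa [blockIndex, hne] using hn'), if_pos (by simp [blockIndex, hne])]
  · rw [Fintype.sum_prod_type]
    refine Finset.sum_congr rfl fun m _ => ?_
    rw [Fintype.sum_prod_type]
    rw [Finset.sum_eq_single_of_mem n (Finset.mem_univ _) fun n' _ hn' =>
      Finset.sum_eq_zero fun a _ => if_neg (by simpa [blockIndex] using hn')]
    exact Finset.sum_congr rfl fun a _ => if_pos (by simp [blockIndex])

/-- Interference plus noise power for given interference gains `g` and noise gains `d`. -/
def noisePower (net : Network M K τp) (k : Fin K) (g : Fin K → ℂ) (d : Fin M → Fin N → ℂ) : ℝ :=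
  ∑ k' ∈ Finset.univ.erase k, ‖g k'‖ ^ 2 + (∑ m, ∑ a, ‖d m a‖ ^ 2) * (net.σw : ℝ) ^ 2

/-- Interference plus noise for given interference gains `g` and noise gains `d`. -/
def noiseVector (k : Fin K) (g : Fin K → ℂ) (d : Fin M → Fin N → ℂ)
    (x : (Fin K × Fin τu) ⊕ (Fin M × Fin τu × Fin N) → ℂ) (n : Fin τu) : ℂ :=
  ∑ k' ∈ Finset.univ.erase k, g k' * x (.inl (k', n)) + ∑ m, ∑ a, d m a * x (.inr (m, n, a))

/-- For frozen gains, the symbols of user `k` and the disturbances of the different samples involve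
disjoint sets of data variables. They are therefore `2 τu` independent block sums, and dividing by
`√s` makes every variance one. -/
lemma map_normalized_noiseVector (net : Network M K τp) (k : Fin K) (g : Fin K → ℂ)
    (d : Fin M → Fin N → ℂ) (hpos : 0 < noisePower net k g d) :
    (Measure.pi fun i => complexGaussian (net.dataVar i)).map
        (fun x => ((fun n : Fin τu => x (.inl (k, n))),
          (√(noisePower net k g d) : ℂ)⁻¹ • noiseVector k g d x)) =
      (stdComplexGaussian (Fin τu)).prod (stdComplexGaussian (Fin τu)) := by
  set s := noisePower net k g d with hs
  set c : (Fin K × Fin τu) ⊕ (Fin M × Fin τu × Fin N) → ℂ :=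
    Sum.elim (fun x => if x.1 = k then 1 else (√s : ℂ)⁻¹ * g x.1)
      (fun x => (√s : ℂ)⁻¹ * d x.1 x.2.2) with hc
  have h1 := map_pi_complexGaussian_blockSum (net.dataVar) (blockIndex k) c
  have hvar : ∀ j, ∑ i with blockIndex k i = j, ‖c i‖₊ ^ 2 * net.dataVar i = 1 := by
    rintro (n | n)
    · rw [sum_blockIndex_inl]
      simp [hc, Network.dataVar]
    · rw [sum_blockIndex_inr]
      have e1 : ∀ k' ∈ Finset.univ.erase k, ‖c (.inl (k', n))‖₊ ^ 2 * net.dataVar (N := N)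
          (M := M) (.inl (k', n)) = ‖(√s : ℂ)⁻¹‖₊ ^ 2 * ‖g k'‖₊ ^ 2 := by
        intro k' hk'
        simp [hc, Network.dataVar, Finset.ne_of_mem_erase hk', mul_pow]
      rw [Finset.sum_congr rfl e1]
      ext
      simp only [hc, Network.dataVar, Sum.elim_inr, ← Finset.mul_sum]
      push_cast
      simp only [norm_mul, mul_pow, norm_inv, Complex.norm_real, inv_pow, Real.norm_eq_abs,
        sq_abs, Real.sq_sqrt hpos.le, ← Finset.mul_sum, ← Finset.sum_mul, mul_assoc]
      rw [← mul_add]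
      exact inv_mul_cancel₀ hpos.ne'
  simp only [hvar] at h1
  have h2 := congrArg (Measure.map (MeasurableEquiv.sumPiEquivProdPi fun _ : Fin τu ⊕ Fin τu => ℂ))
    h1
  rw [(measurePreserving_sumPiEquivProdPi fun _ : Fin τu ⊕ Fin τu => complexGaussian 1).map_eq,
    Measure.map_map (MeasurableEquiv.measurable _) (by fun_prop)] at h2
  refine Eq.trans ?_ h2
  congr 1
  ext x n
  · simp [MeasurableEquiv.sumPiEquivProdPi, Equiv.sumPiEquivProdPi, sum_blockIndex_inl, hc]
  · have e1 : ∀ k' ∈ Finset.univ.erase k, c (.inl (k', n)) * x (.inl (k', n)) =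
        (√s : ℂ)⁻¹ * (g k' * x (.inl (k', n))) := by
      intro k' hk'
      simp [hc, Finset.ne_of_mem_erase hk', mul_assoc]
    simp only [MeasurableEquiv.sumPiEquivProdPi, Equiv.sumPiEquivProdPi, MeasurableEquiv.coe_mk,
      Equiv.coe_fn_mk, Function.comp_apply, sum_blockIndex_inr, Finset.sum_congr rfl e1]
    simp only [noiseVector, hc, Pi.smul_apply, smul_eq_mul, mul_add, Finset.mul_sum, mul_assoc,
      Sum.elim_inr]

end

/-! ### Moments, positivity and log-integrability of the powers -/

section

variable {Ω : Type*} [MeasurableSpace Ω] {M N K τp τu : ℕ} {net : Network M K τp}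
  {S : Sources Ω M N K τp τu} {P : Measure Ω}

/-- The interference plus noise power, conditionally on the channels and their estimates. -/
def residualPower (net : Network M K τp) (S : Sources Ω M N K τp τu) (P : Measure Ω) (k : Fin K)
    (ω : Ω) : ℝ :=
  ∑ k' ∈ Finset.univ.erase k, ‖effChannel net S P k k' ω‖ ^ 2 +
    noiseGain net S P k ω * (net.σw : ℝ) ^ 2

lemma IsModel.memLp_channel (hS : IsModel net S P) (m : Fin M) (k : Fin K) (a : Fin N) {p : ℝ≥0∞}
    (hp : p ≠ ∞) : MemLp (channel net S m k a) p P :=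
  (memLp_of_hasLaw_complexGaussian (hS.law_h m k a) hp).const_mul _

lemma IsModel.memLp_estChannel (hS : IsModel net S P) (m : Fin M) (k : Fin K) (a : Fin N)
    {p : ℝ≥0∞} (hp : p ≠ ∞) : MemLp (estChannel net S P m k a) p P := by
  obtain ⟨κ, -, hκ⟩ := hS.exists_estChannel_eq
  have := (memLp_of_hasLaw_complexGaussian (hS.hasLaw_projPilot m k a) hp).const_mul (κ m k a)
  exact this.ae_eq (.of_forall fun ω => (hκ m k a ω).symm)

lemma IsModel.memLp_effChannel (hS : IsModel net S P) (k k' : Fin K) :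
    MemLp (effChannel net S P k k') 2 P := by
  -- The effective channel is a sum of products of two correlated Gaussians; Hölder with `L⁴`
  -- factors avoids any independence.
  have : ENNReal.HolderTriple 4 4 2 := ⟨by
    rw [← ENNReal.toReal_eq_toReal_iff' (by simp) (by simp), ENNReal.toReal_add (by simp) (by simp)]
    norm_num⟩
  have h1 : ∀ m a, MemLp (fun ω => conj (estChannel net S P m k a ω) * channel net S m k' a ω)
      2 P := fun m a => (hS.memLp_channel m k' a (p := 4) (by simp)).mul
    (hS.memLp_estChannel m k a (p := 4) (by simp)).star
  have h2 : ∀ m, MemLp (fun ω => ∑ a, conj (estChannel net S P m k a ω) * channel net S m k' a ω)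
      2 P := fun m => memLp_finsetSum _ fun a _ => h1 m a
  exact memLp_finsetSum _ fun m _ => (h2 m).const_mul _

lemma IsModel.integrable_noiseGain (hS : IsModel net S P) (k : Fin K) :
    Integrable (noiseGain net S P k) P := by
  unfold noiseGain
  refine integrable_finsetSum _ fun m _ => integrable_finsetSum _ fun a _ => ?_
  exact ((hS.memLp_estChannel m k a (p := 2) (by simp)).star.const_mul _).integrable_norm_pow
    (by simp)

lemma IsModel.integrable_residualPower (hS : IsModel net S P) (k : Fin K) :
    Integrable (residualPower net S P k) P :=
  (integrable_finsetSum _ fun k' _ => (hS.memLp_effChannel k k').integrable_norm_pow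
    (by simp)).add ((hS.integrable_noiseGain k).mul_const _)

lemma IsModel.integral_residualPower (hS : IsModel net S P) (k : Fin K) :
    ∫ ω, residualPower net S P k ω ∂P = meanInterference net S P k := by
  have h : ∀ k' ∈ Finset.univ.erase k, Integrable (fun ω => ‖effChannel net S P k k' ω‖ ^ 2) P :=
    fun k' _ => (hS.memLp_effChannel k k').integrable_norm_pow (by simp)
  unfold residualPower meanInterference
  rw [integral_add (integrable_finsetSum _ h) ((hS.integrable_noiseGain k).mul_const _),
    integral_finsetSum _ h, integral_mul_const]

/-- One antenna of one serving access point suffices: its noise gain is a positive multiple of a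
squared Gaussian modulus. Positivity of the power and control of its logarithm near zero both
follow. -/
lemma IsModel.exists_le_residualPower (hS : IsModel net S P) (hN : 0 < N) (k : Fin K)
    (hk : ∃ m, net.c m k = 1) :
    ∃ m a, ∃ b : ℝ, 0 < b ∧
      ∀ ω, b * ‖projPilot net S m k a ω‖ ^ 2 ≤ residualPower net S P k ω := by
  obtain ⟨m, hm⟩ := hk
  obtain ⟨κ, hκ0, hκ⟩ := hS.exists_estChannel_eq
  have hσ : (0 : ℝ) < net.σw := net.σw_pos
  have hκ' := norm_pos_iff.2 (hκ0 m k ⟨0, hN⟩)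
  refine ⟨m, ⟨0, hN⟩, ‖κ m k ⟨0, hN⟩‖ ^ 2 * (net.σw : ℝ) ^ 2, by positivity, fun ω => ?_⟩
  have h1 : ‖κ m k ⟨0, hN⟩‖ ^ 2 * ‖projPilot net S m k ⟨0, hN⟩ ω‖ ^ 2 ≤ noiseGain net S P k ω := by
    calc _ = ‖(net.c m k : ℂ) * conj (estChannel net S P m k ⟨0, hN⟩ ω)‖ ^ 2 := by
          simp [hm, hκ, mul_pow]
      _ ≤ ∑ a, ‖(net.c m k : ℂ) * conj (estChannel net S P m k a ω)‖ ^ 2 :=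
          Finset.single_le_sum (f := fun a =>
            ‖(net.c m k : ℂ) * conj (estChannel net S P m k a ω)‖ ^ 2)
            (fun _ _ => by positivity) (Finset.mem_univ _)
      _ ≤ _ := Finset.single_le_sum (f := fun m => ∑ a,
            ‖(net.c m k : ℂ) * conj (estChannel net S P m k a ω)‖ ^ 2)
            (fun _ _ => Finset.sum_nonneg fun _ _ => by positivity) (Finset.mem_univ _)
  have h2 : 0 ≤ ∑ k' ∈ Finset.univ.erase k, ‖effChannel net S P k k' ω‖ ^ 2 :=
    Finset.sum_nonneg fun _ _ => by positivity
  have h3 := mul_le_mul_of_nonneg_right h1 (sq_nonneg (net.σw : ℝ))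
  unfold residualPower
  linarith

lemma IsModel.ae_projPilot_ne_zero (hS : IsModel net S P) (m : Fin M) (k : Fin K) (a : Fin N) :
    ∀ᵐ ω ∂P, projPilot net S m k a ω ≠ 0 := by
  have h := ae_ne_zero_complexGaussian (pilotVar_pos (net := net) m k a).ne'
  rw [← (hS.hasLaw_projPilot m k a).map_eq] at h
  exact ae_of_ae_map (hS.hasLaw_projPilot m k a).aemeasurable h

lemma IsModel.ae_residualPower_pos (hS : IsModel net S P) (hN : 0 < N) (k : Fin K)
    (hk : ∃ m, net.c m k = 1) : ∀ᵐ ω ∂P, 0 < residualPower net S P k ω := by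
  obtain ⟨m, a, b, hb, h⟩ := hS.exists_le_residualPower hN k hk
  filter_upwards [hS.ae_projPilot_ne_zero m k a] with ω hω
  have := norm_pos_iff.2 hω
  exact lt_of_lt_of_le (by positivity) (h ω)

lemma IsModel.meanInterference_pos [IsProbabilityMeasure P] (hS : IsModel net S P) (hN : 0 < N)
    (k : Fin K) (hk : ∃ m, net.c m k = 1) : 0 < meanInterference net S P k := by
  have hpos := hS.ae_residualPower_pos hN k hk
  rw [← hS.integral_residualPower, integral_pos_iff_support_of_nonneg_ae
    (hpos.mono fun ω h => h.le) (hS.integrable_residualPower k),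
    measure_congr (t := Set.univ)]
  · simp
  filter_upwards [hpos] with ω hω
  exact (eq_true hω.ne').trans (eq_true trivial).symm

lemma IsModel.integrable_log_power (hS : IsModel net S P) (hN : 0 < N) (k : Fin K)
    (hk : ∃ m, net.c m k = 1) :
    Integrable (fun ω => Real.log (‖effChannel net S P k k ω‖ ^ 2 + residualPower net S P k ω))
      P := by
  have := hS.indep.isProbabilityMeasure
  obtain ⟨m, a, b, hb, h⟩ := hS.exists_le_residualPower hN k hk
  have hi : Integrable (fun ω => ‖effChannel net S P k k ω‖ ^ 2 + residualPower net S P k ω) P :=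
    ((hS.memLp_effChannel k k).integrable_norm_pow (by simp)).add (hS.integrable_residualPower k)
  have hl : Integrable (fun ω => Real.log ‖projPilot net S m k a ω‖) P := by
    have h := integrable_log_norm_complexGaussian (pilotVar_pos (net := net) m k a).ne'
    rw [← (hS.hasLaw_projPilot m k a).map_eq] at h
    exact (integrable_map_measure (Measurable.aestronglyMeasurable (by fun_prop))
      (hS.hasLaw_projPilot m k a).aemeasurable).1 h
  refine integrable_of_le_of_le
    (g₁ := fun ω => Real.log b + 2 * Real.log ‖projPilot net S m k a ω‖)
    (g₂ := fun ω => ‖effChannel net S P k k ω‖ ^ 2 + residualPower net S P k ω)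
    (Real.measurable_log.comp_aemeasurable hi.aemeasurable).aestronglyMeasurable ?_ ?_
    ((integrable_const _).add (hl.const_mul 2)) hi
  · filter_upwards [hS.ae_projPilot_ne_zero m k a] with ω hω
    have hω' := norm_pos_iff.2 hω
    rw [← Nat.cast_ofNat, ← Real.log_pow, ← Real.log_mul hb.ne' (by positivity)]
    refine Real.log_le_log (by positivity) ((h ω).trans ?_)
    exact le_add_of_nonneg_left (by positivity)
  · filter_upwards [hS.ae_residualPower_pos hN k hk] with ω hω
    exact Real.log_le_self (by positivity)

end

/-! ### Reduction of the network to the fading channel -/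

section

variable {Ω : Type*} [MeasurableSpace Ω] {M N K τp τu : ℕ} {net : Network M K τp}
  {S : Sources Ω M N K τp τu} {P : Measure Ω}

/-- The training variables as coordinates on their product space. -/
def coordSources (M N K τp : ℕ) :
    Sources ((Fin M × Fin K × Fin N) ⊕ (Fin M × Fin N × Fin τp) → ℂ) M N K τp 0 where
  h m k a x := x (.inl (m, k, a))
  W m a t x := x (.inr (m, a, t))
  -- With zero data samples the index type is empty, so these values are immaterial.
  q _ _ _ := 0
  w _ _ _ _ := 0

lemma measurable_projPilot_coordSources (m : Fin M) (k : Fin K) (a : Fin N) :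
    Measurable (projPilot net (coordSources M N K τp) m k a) := by
  unfold projPilot rxPilot channel coordSources
  fun_prop

lemma measurable_channel_coordSources (m : Fin M) (k : Fin K) (a : Fin N) :
    Measurable (channel net (coordSources M N K τp) m k a) := by
  unfold channel coordSources
  fun_prop

/-- The effective channels and the noise gains are measurable functions of the training
variables. -/
lemma IsModel.exists_gains (hS : IsModel net S P) (k : Fin K) :
    ∃ (g : ((Fin M × Fin K × Fin N) ⊕ (Fin M × Fin N × Fin τp) → ℂ) → Fin K → ℂ)
      (d : ((Fin M × Fin K × Fin N) ⊕ (Fin M × Fin N × Fin τp) → ℂ) → Fin M → Fin N → ℂ),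
      Measurable g ∧ Measurable d ∧
      (∀ k' ω, effChannel net S P k k' ω = g (fun i => S.training i ω) k') ∧
      ∀ m a ω, (net.c m k : ℂ) * conj (estChannel net S P m k a ω) =
        d (fun i => S.training i ω) m a := by
  obtain ⟨κ, -, hκ⟩ := hS.exists_estChannel_eq
  have h1 := fun m k a => measurable_projPilot_coordSources (net := net) (N := N) m k a
  have h2 := fun m k a => measurable_channel_coordSources (net := net) (N := N) m k a
  have h3 : ∀ m k a, Measurable fun x => conj (κ m k a *
      projPilot net (coordSources M N K τp) m k a x) := fun m k a =>
    Complex.continuous_conj.measurable.comp ((h1 m k a).const_mul _)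
  -- The correlations inside the estimate are frozen into the constants `κ`, so no measure on the
  -- coordinate space is involved.
  refine ⟨fun x k' => ∑ m, (√(net.ρu * net.η k') : ℂ) * (net.c m k : ℂ) *
      ∑ a, conj (κ m k a * projPilot net (coordSources M N K τp) m k a x) *
        channel net (coordSources M N K τp) m k' a x,
    fun x m a => (net.c m k : ℂ) *
      conj (κ m k a * projPilot net (coordSources M N K τp) m k a x), ?_, ?_, ?_, ?_⟩
  · exact measurable_pi_lambda _ fun k' => Finset.measurable_fun_sum _ fun m _ =>
      (Finset.measurable_fun_sum _ fun a _ => (h3 m k a).mul (h2 m k' a)).const_mul _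
  · exact measurable_pi_lambda _ fun m => measurable_pi_lambda _ fun a => (h3 m k a).const_mul _
  · intro k' ω
    simp only [effChannel, hκ]
    rfl
  · intro m a ω
    simp only [hκ]
    rfl

lemma rxCPU_eq (k : Fin K) (n : Fin τu) (ω : Ω) :
    rxCPU net S P k n ω = effChannel net S P k k ω * S.q k n ω +
      noiseVector k (fun k' => effChannel net S P k k' ω)
        (fun m a => (net.c m k : ℂ) * conj (estChannel net S P m k a ω))
        (fun i => S.data i ω) n := by
  have h1 : rxCPU net S P k n ω = ∑ k', effChannel net S P k k' ω * S.q k' n ω +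
      ∑ m, ∑ a, (net.c m k : ℂ) * conj (estChannel net S P m k a ω) * S.w m n a ω := by
    have h2 : ∀ m a, (net.c m k : ℂ) * (conj (estChannel net S P m k a ω) *
        rxData net S m n a ω) =
        ∑ k', (√(net.ρu * net.η k') : ℂ) * (net.c m k : ℂ) * (conj (estChannel net S P m k a ω) *
          channel net S m k' a ω) * S.q k' n ω +
        (net.c m k : ℂ) * conj (estChannel net S P m k a ω) * S.w m n a ω := by
      intro m a
      rw [rxData, mul_add, mul_add, Finset.mul_sum, Finset.mul_sum]
      congr 1
      · refine Finset.sum_congr rfl fun k' _ => ?_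
        rw [txData]
        ring
      · ring
    simp only [rxCPU, effChannel, Finset.mul_sum, Finset.sum_mul, h2, Finset.sum_add_distrib]
    congr 1
    rw [Finset.sum_congr rfl fun m _ => Finset.sum_comm, Finset.sum_comm]
  rw [h1, ← Finset.add_sum_erase _ _ (Finset.mem_univ k), add_assoc]
  rfl

/-- Conditionally on the training variables, the signal seen by user `k` is the output of a fading
channel. -/
lemma IsModel.ofReal_le_klDiv [IsProbabilityMeasure P] (hS : IsModel net S P) (hN : 0 < N)
    (k : Fin K) (hk : ∃ m, net.c m k = 1) :
    ENNReal.ofReal (τu * (∫ ω, Real.log (‖effChannel net S P k k ω‖ ^ 2 +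
          residualPower net S P k ω) ∂P - Real.log (meanInterference net S P k)) -
        Real.log (1 + τu * complexVariance (effChannel net S P k k) P /
          meanInterference net S P k)) ≤
      InformationTheory.klDiv (P.map fun ω => ((fun n => S.q k n ω), fun n => rxCPU net S P k n ω))
        ((P.map fun ω n => S.q k n ω).prod (P.map fun ω n => rxCPU net S P k n ω)) := by
  obtain ⟨g, d, hg, hd, hgeq, hdeq⟩ := hS.exists_gains k
  set μA := Measure.pi fun i => complexGaussian
    (net.trainingVar (N := N) i) with hμA
  set X : Ω → (Fin M × Fin K × Fin N) ⊕ (Fin M × Fin N × Fin τp) → ℂ :=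
    fun ω i => S.training i ω with hX
  set Y : Ω → (Fin K × Fin τu) ⊕ (Fin M × Fin τu × Fin N) → ℂ := fun ω i => S.data i ω with hY
  have hXY := hS.hasLaw_training_data
  have hXlaw : HasLaw X μA P := measurePreserving_fst.hasLaw.comp hXY
  set f := fun x => g x k with hf
  set s := fun x => noisePower net k (g x) (d x) with hs
  have hfm : Measurable f := by fun_prop
  have hsm : Measurable s := by
    simp only [hs, noisePower]
    fun_prop
  have hfe : ∀ ω, effChannel net S P k k ω = f (X ω) := hgeq k
  have hse : ∀ ω, residualPower net S P k ω = s (X ω) := fun ω => by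
    simp only [residualPower, noiseGain, hgeq, hdeq, hs, noisePower, hX]
  have hspos : ∀ᵐ x ∂μA, 0 < s x := by
    rw [← hXlaw.map_eq, ae_map_iff hXlaw.aemeasurable (measurableSet_lt measurable_const hsm)]
    simpa only [hse] using hS.ae_residualPower_pos hN k hk
  have hsi : Integrable s μA := by
    rw [← hXlaw.map_eq, integrable_map_measure hsm.aestronglyMeasurable hXlaw.aemeasurable]
    exact (hS.integrable_residualPower k).congr (.of_forall hse)
  have hf2 : MemLp f 2 μA := by
    rw [← hXlaw.map_eq, memLp_map_measure_iff hfm.aestronglyMeasurable hXlaw.aemeasurable]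
    exact (hS.memLp_effChannel k k).ae_eq (.of_forall hfe)
  have hlm : Measurable fun x => Real.log (‖f x‖ ^ 2 + s x) := by fun_prop
  have hlog : Integrable (fun x => Real.log (‖f x‖ ^ 2 + s x)) μA := by
    rw [← hXlaw.map_eq, integrable_map_measure hlm.aestronglyMeasurable hXlaw.aemeasurable]
    exact (hS.integrable_log_power hN k hk).congr (.of_forall fun ω => by simp [hfe, hse])
  have hint : ∀ F : ((Fin M × Fin K × Fin N) ⊕ (Fin M × Fin N × Fin τp) → ℂ) → ℝ, Measurable F →
      ∫ x, F x ∂μA = ∫ ω, F (X ω) ∂P := fun F hF => by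
    rw [← hXlaw.map_eq, integral_map hXlaw.aemeasurable hF.aestronglyMeasurable]
  have hmain := ofReal_le_klDiv_fadingOutput (ι := Fin τu) (ρ := μA) hfm hsm hspos hsi hf2 hlog
    (hS.meanInterference_pos hN k hk) (∫ ω, effChannel net S P k k ω ∂P)
    (by simp only [hint s hsm, ← hse, hS.integral_residualPower])
    (V := complexVariance (effChannel net S P k k) P)
    (by rw [hint _ (by fun_prop)]; simp only [← hfe, complexVariance])
  rw [hint _ hlm] at hmain
  simp only [← hfe, ← hse, Fintype.card_fin] at hmain
  -- the joint law of gains, symbols and normalized noise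
  have hΨ : MeasurePreserving
      (fun p : ((Fin M × Fin K × Fin N) ⊕ (Fin M × Fin N × Fin τp) → ℂ) ×
          ((Fin K × Fin τu) ⊕ (Fin M × Fin τu × Fin N) → ℂ) =>
        (p.1, ((fun n : Fin τu => p.2 (.inl (k, n))),
          (√(s p.1) : ℂ)⁻¹ • noiseVector k (g p.1) (d p.1) p.2)))
      (μA.prod (Measure.pi fun i => complexGaussian (net.dataVar i)))
      (μA.prod ((stdComplexGaussian (Fin τu)).prod (stdComplexGaussian (Fin τu)))) := by
    refine (MeasurePreserving.id μA).skew_product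
      (g := fun x y => ((fun n : Fin τu => y (.inl (k, n))),
          (√(s x) : ℂ)⁻¹ • noiseVector k (g x) (d x) y)) ?_ ?_
    · unfold Function.uncurry noiseVector
      fun_prop
    · filter_upwards [hspos] with x hx
      exact map_normalized_noiseVector net k (g x) (d x) hx
  have hZ := hΨ.hasLaw.comp hXY
  -- Undoing the normalization by `√s` needs `s > 0`, which holds only almost surely; this is enough
  -- for equality of laws.
  have hr : ∀ᵐ ω ∂P, (fun n => rxCPU net S P k n ω) = fadingOutput f s
      (X ω, ((fun n : Fin τu => S.q k n ω),
        (√(s (X ω)) : ℂ)⁻¹ • noiseVector k (g (X ω)) (d (X ω)) (Y ω))) := by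
    filter_upwards [hS.ae_residualPower_pos hN k hk] with ω hω
    rw [hse] at hω
    have h0 : (√(s (X ω)) : ℂ) ≠ 0 := by exact_mod_cast (Real.sqrt_pos.2 hω).ne'
    ext n
    simp only [fadingOutput]
    rw [smul_inv_smul₀ h0, rxCPU_eq]
    simp only [hgeq, hdeq, hf, hX, hY, Pi.add_apply, Pi.smul_apply, smul_eq_mul]
  have hq : P.map (fun ω n => S.q k n ω) = stdComplexGaussian (Fin τu) :=
    ((measurePreserving_fst.comp (measurePreserving_snd (μ := μA))).hasLaw.comp hZ).map_eq
  have hfo := measurable_fadingOutput (ι := Fin τu) hfm hsm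
  have hr' : P.map (fun ω n => rxCPU net S P k n ω) =
      (μA.prod ((stdComplexGaussian (Fin τu)).prod (stdComplexGaussian (Fin τu)))).map
        (fadingOutput f s) := by
    rw [← hZ.map_eq, AEMeasurable.map_map_of_aemeasurable hfo.aemeasurable hZ.aemeasurable]
    exact Measure.map_congr hr
  have hqr : P.map (fun ω => ((fun n => S.q k n ω), fun n => rxCPU net S P k n ω)) =
      (μA.prod ((stdComplexGaussian (Fin τu)).prod (stdComplexGaussian (Fin τu)))).map
        (fun p => (p.2.1, fadingOutput f s p)) := by
    rw [← hZ.map_eq, AEMeasurable.map_map_of_aemeasurable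
      (Measurable.aemeasurable (by fun_prop)) hZ.aemeasurable]
    refine Measure.map_congr ?_
    filter_upwards [hr] with ω hω
    simp only [hω]
    rfl
  rw [hqr, hq, hr']
  exact hmain

lemma logTerm_eq (k : Fin K) (ω : Ω) :
    logTerm net S P k ω = Real.logb 2 ((‖effChannel net S P k k ω‖ ^ 2 +
      residualPower net S P k ω) / meanInterference net S P k) := by
  rw [logTerm, residualPower, add_assoc]

lemma IsModel.logTerm_ae_eq [IsProbabilityMeasure P] (hS : IsModel net S P) (hN : 0 < N)
    (k : Fin K) (hk : ∃ m, net.c m k = 1) :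
    logTerm net S P k =ᵐ[P] fun ω => (Real.log (‖effChannel net S P k k ω‖ ^ 2 +
      residualPower net S P k ω) - Real.log (meanInterference net S P k)) / Real.log 2 := by
  filter_upwards [hS.ae_residualPower_pos hN k hk] with ω hω
  rw [logTerm_eq, Real.logb, Real.log_div (by positivity)
    (hS.meanInterference_pos hN k hk).ne']

end

end CellFree

end

/-! ### The rate bound -/

theorem proposition1 {M N K τp τu : ℕ} (hN : 0 < N) (hτu : 0 < τu)
    {Ω : Type*} [MeasurableSpace Ω] (P : Measure Ω) [IsProbabilityMeasure P]
    (net : CellFree.Network M K τp) (S : CellFree.Sources Ω M N K τp τu)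
    (hS : CellFree.IsModel net S P) (k : Fin K) (hk : ∃ m, net.c m k = 1) :
    (∀ k', MemLp (CellFree.effChannel net S P k k') 2 P) ∧
    Integrable (CellFree.noiseGain net S P k) P ∧
    0 < CellFree.meanInterference net S P k ∧
    Integrable (CellFree.logTerm net S P k) P ∧
    ((CellFree.rateProp net S P k : ℝ) : EReal) ≤ (CellFree.rate net S P k : EReal) := by
  have hlog := hS.integrable_log_power hN k hk
  have hterm := hS.logTerm_ae_eq hN k hk
  refine ⟨fun k' => hS.memLp_effChannel k k', hS.integrable_noiseGain k,
    hS.meanInterference_pos hN k hk,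
    ((hlog.sub (integrable_const _)).div_const _).congr hterm.symm, ?_⟩
  have hτ : (0 : ℝ) < τu := by exact_mod_cast hτu
  have hlog2 : 0 < Real.log 2 := Real.log_pos one_lt_two
  have hkl := hS.ofReal_le_klDiv hN k hk
  set R := τu * (∫ ω, Real.log (‖CellFree.effChannel net S P k k ω‖ ^ 2 +
          CellFree.residualPower net S P k ω) ∂P - Real.log (CellFree.meanInterference net S P k)) -
        Real.log (1 + τu * CellFree.complexVariance (CellFree.effChannel net S P k k) P /
          CellFree.meanInterference net S P k) with hR
  have hprop : CellFree.rateProp net S P k = R / Real.log 2 / τu := by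
    rw [CellFree.rateProp, integral_congr_ae hterm, integral_div,
      integral_sub hlog (integrable_const _), Real.logb, hR]
    simp only [integral_const, probReal_univ, one_smul]
    field_simp
  -- The bound may be negative whereas the rate is `ℝ≥0∞`-valued. The comparison is made for the
  -- truncation at zero, which dominates the bound in `EReal`.
  have hle : ENNReal.ofReal (CellFree.rateProp net S P k) ≤ CellFree.rate net S P k := by
    rw [hprop, ENNReal.ofReal_div_of_pos hτ, ENNReal.ofReal_div_of_pos hlog2,
      ENNReal.ofReal_natCast, CellFree.rate, CellFree.mutualInfo]
    gcongr
  refine le_trans ?_ (EReal.coe_ennreal_le_coe_ennreal_iff.2 hle)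
  rw [EReal.coe_ennreal_ofReal]
  exact_mod_cast le_max_left _ _
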